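/- Let $(a_n)_{n\ge 0}$ be a sequence of (real or complex) numbers satisfying the $L^2$-Hausdorff condition: there is a constant $M>0$ with $$(n+1)\sum_{i=0}^n \binom{n}{i}^2\,|\Delta^i a_{n-i}|^2 < M\qquad (n=0,1,2,\dots),$$ where $\Delta a_n=a_{n+1}-a_n$. Then the series $\frac1{2\pi}\sum_{n\ge0}a_n e^{-in\theta}$, which converges for $\operatorname{Im}\theta<0$, has a holomorphic extension $f$ to the cut plane $\mathbb{C}\setminus\{2k\pi+iv : k\in\mathbb{Z},\ v\ge 0\}$. The boundary values $f_\pm(iv)=\lim_{\varepsilon\to0^+}f(\pm\varepsilon+iv)$ exist for almost every $v>0$, and the jump function $F(v)=i\,[f_+(iv)-f_-(iv)]$ satisfies $e^{v/2}F(v)\in L^2(0,\infty)$ and $$e^{v/2}F(v)=\sum_{m=0}^\infty c_m\,\Phi_m(v)\qquad (v>0)$$ with convergence in the norm of $L^2(0,\infty)$. Here $$c_m=\sqrt2\,\sum_{n=0}^\infty\frac{(-1)^n}{n!}\,a_n\,P_m\!\left[-i\left(n+\tfrac12\right)\right]$$ (the series converges absolutely) and $$\Phi_m(v)=i^m\sqrt2\,L_m(2e^{-v})\,e^{-e^{-v}}e^{-v/2},$$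 where $L_m(x)=\sum_{k=0}^m\binom mk\frac{(-x)^k}{k!}$ are the Laguerre polynomials and $P_m$ are the Pollaczek polynomials with $\alpha=\tfrac12$, i.e. the polynomials orthonormal on $\mathbb{R}$ with weight $\frac1\pi|\Gamma(\tfrac12+i\nu)|^2$ and with positive leading coefficients, given by $P_0=1$, $P_1(\nu)=2\nu$, $(m+1)P_{m+1}(\nu)=2\nu P_m(\nu)-mP_{m-1}(\nu)$. -/

import Mathlib

open MeasureTheory Filter Topology Polynomial

/-- The `L²`-Hausdorff condition: there is a constant `M > 0` with
`(n+1) ∑_{i=0}^n (n choose i)² |Δⁱ a_{n-i}|² < M` for all `n`, where `Δ a_n = a_{n+1} - a_n`. -/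
def HausdorffL2 (a : ℕ → ℂ) : Prop :=
  ∃ M : ℝ, 0 < M ∧ ∀ n : ℕ,
    ((n : ℝ) + 1) * ∑ i ∈ Finset.range (n + 1),
      (n.choose i : ℝ) ^ 2 * ‖((fwdDiff (1 : ℕ))^[i] a) (n - i)‖ ^ 2 < M

/-- The `θ`-plane cut along the half-lines `{2kπ + iv : v ≥ 0}`, `k ∈ ℤ`. -/
def cutDomain : Set ℂ :=
  {θ : ℂ | ¬ ∃ (k : ℤ) (v : ℝ), 0 ≤ v ∧ θ = 2 * Real.pi * k + Complex.I * v}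

/-- `f` is holomorphic in the cut plane, and in the lower half-plane it is the sum of the
trigonometric series `(1/2π) ∑ a_n e^{-inθ}`. (The values of `f` on the cuts are irrelevant.) -/
def IsHolomorphicExtension (a : ℕ → ℂ) (f : ℂ → ℂ) : Prop :=
  DifferentiableOn ℂ f cutDomain ∧
    ∀ θ : ℂ, θ.im < 0 →
      HasSum (fun n : ℕ => 1 / (2 * (Real.pi : ℂ)) * (a n * Complex.exp (-(Complex.I * n * θ))))
        (f θ)

/-- `F` is the jump function of `f` across the cut `{iv : v > 0}`: for almost every `v > 0` the
boundary values `f₊(iv) = lim_{ε → 0+} f(ε + iv)` and `f₋(iv) = lim_{ε → 0+} f(-ε + iv)` exist, and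
`F(v) = i (f₊(iv) - f₋(iv))`. -/
def IsJumpFunction (f : ℂ → ℂ) (F : ℝ → ℂ) : Prop :=
  ∀ᵐ v : ℝ ∂(volume.restrict (Set.Ioi (0 : ℝ))), ∃ fp fm : ℂ,
    Tendsto (fun ε : ℝ => f ((ε : ℂ) + Complex.I * v)) (𝓝[>] (0 : ℝ)) (𝓝 fp) ∧
    Tendsto (fun ε : ℝ => f (-(ε : ℂ) + Complex.I * v)) (𝓝[>] (0 : ℝ)) (𝓝 fm) ∧
    F v = Complex.I * (fp - fm)

/-- The Pollaczek polynomials `P_m^{(α)}`, orthogonal on the real line with respect to the weight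
`π⁻¹ 2^{2α-1} |Γ(α + iν)|²`, by their three-term recurrence
`(m+1) P_{m+1}(ν) = 2 ν P_m(ν) - (m + 2α - 1) P_{m-1}(ν)`, `P_0 = 1`, `P_{-1} = 0`.
For `α = 1/2` they are orthonormal. -/
noncomputable def pollaczek (α : ℝ) : ℕ → ℂ[X]
  | 0 => 1
  | 1 => C 2 * X
  | (m + 2) => C (1 / ((m : ℂ) + 2)) *
      (C 2 * X * pollaczek α (m + 1) - C ((m : ℂ) + 2 * (α : ℂ)) * pollaczek α m)

/-- The Laguerre polynomials `L_m(x) = ∑_{k=0}^m (m choose k) (-x)^k / k!`. -/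
noncomputable def laguerre (m : ℕ) : ℝ[X] :=
  ∑ k ∈ Finset.range (m + 1), C ((-1) ^ k * (m.choose k : ℝ) / (k.factorial : ℝ)) * X ^ k

/-- The terms `((-1)^n / n!) a_n P_m[-i(n + 1/2)]`, with `α = 1/2`. -/
noncomputable def jumpCoeffTerm (a : ℕ → ℂ) (m n : ℕ) : ℂ :=
  (-1) ^ n / (n.factorial : ℂ) * a n *
    (pollaczek (1 / 2) m).eval (-Complex.I * ((n : ℂ) + 1 / 2))

/-- `c_m = √2 ∑_n ((-1)^n / n!) a_n P_m[-i(n + 1/2)]`. -/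
noncomputable def jumpCoeff (a : ℕ → ℂ) (m : ℕ) : ℂ :=
  (Real.sqrt 2 : ℂ) * ∑' n : ℕ, jumpCoeffTerm a m n

/-- `Φ_m(v) = i^m √2 L_m(2 e^{-v}) e^{-e^{-v}} e^{-v/2}`. -/
noncomputable def laguerreFun (m : ℕ) (v : ℝ) : ℂ :=
  Complex.I ^ m *
    ((Real.sqrt 2 * (laguerre m).eval (2 * Real.exp (-v)) * Real.exp (-Real.exp (-v)) *
      Real.exp (-v / 2) : ℝ) : ℂ)

/-! The substitution `x = e^{-v}` turns the theorem into one about moments on `(0, 1)`. The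
Hausdorff condition says that the step densities built from `(n choose k) (-1)^(n-k) Δ^(n-k) a_k`
are bounded in `L²`. A weak limit `φ` of them satisfies `a_n = ∫ xⁿ φ(x) dx`
(`HausdorffL2.exists_moments`). Summing a geometric series under the integral gives the
trigonometric series as `(1/2π) e^{iθ} Cφ(e^{iθ})`, where `Cφ(z) = ∫ φ(t)/(z - t) dt`. This is
holomorphic as long as `e^{iθ}` avoids `[0, 1]`, that is, on the cut plane, and the identity theorem
shows that there is no other extension.

Crossing a cut is crossing `(0, 1)` in the variable `e^{iθ}`. The difference of `Cφ` at conjugate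
points is a Poisson integral of `φ`, which converges to a multiple of `φ` almost everywhere. For the
two one-sided limits to exist separately, `Cφ` in the upper half-plane must itself be the Poisson
integral of an `L²` function. This follows from a uniform `L²` bound on horizontal lines
(`integral_norm_cauchyTransform_sq_le`) and weak compactness, and the limits then come from Lebesgue
points (`ae_tendsto_integral_halfPlanePoisson`). The result is `F(v) = e^{-v} φ(e^{-v})`, so
`e^{v/2} F(v) = e^{-v/2} φ(e^{-v})`, whose `L²` norm is controlled by that of `φ`.

It remains to expand `φ` in the complete orthonormal system `√2 L_m(2x) e^{-x}` of `L²(0, ∞)`. The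
Pollaczek values at `-i(n + 1/2)` are `(-i)^m` times Delannoy numbers (`eval_pollaczek_half`), and
the exponential generating function of these in `n` is `L_m(2x) e^{-x}` (`hasSum_delannoy`). Hence
`c_m` is `(-i)^m` times the Laguerre coefficient of `φ`, and the factor `i^m` of `Φ_m` cancels the
phase. -/

/-! ### Pairings and weak compactness in `L²`. -/

/-- Cauchy--Schwarz for the bilinear pairing of square integrable functions. -/
theorem norm_integral_mul_sq_le {α : Type*} [MeasurableSpace α] {μ : Measure α} {f g : α → ℂ}
    (hf : MemLp f 2 μ) (hg : MemLp g 2 μ) :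
    ‖∫ x, f x * g x ∂μ‖ ^ 2 ≤ (∫ x, ‖f x‖ ^ 2 ∂μ) * ∫ x, ‖g x‖ ^ 2 ∂μ := by
  have h := integral_mul_le_Lp_mul_Lq_of_nonneg (μ := μ) (f := fun x => ‖f x‖) (g := fun x => ‖g x‖)
    (Real.HolderConjugate.two_two) (Eventually.of_forall fun x => norm_nonneg _)
    (Eventually.of_forall fun x => norm_nonneg _) (by simpa using hf.norm) (by simpa using hg.norm)
  have h0 : ‖∫ x, f x * g x ∂μ‖ ≤ ∫ x, ‖f x‖ * ‖g x‖ ∂μ := by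
    refine (norm_integral_le_integral_norm _).trans (le_of_eq ?_)
    simp
  have h1 := h0.trans h
  have e1 : 0 ≤ ∫ x, ‖f x‖ ^ 2 ∂μ := integral_nonneg fun x => by positivity
  have e2 : 0 ≤ ∫ x, ‖g x‖ ^ 2 ∂μ := integral_nonneg fun x => by positivity
  simp only [Real.rpow_two, ← Real.sqrt_eq_rpow] at h1
  calc _ ≤ (√(∫ x, ‖f x‖ ^ 2 ∂μ) * √(∫ x, ‖g x‖ ^ 2 ∂μ)) ^ 2 := by gcongr
    _ = _ := by rw [mul_pow, Real.sq_sqrt e1, Real.sq_sqrt e2]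

theorem integral_norm_sq_eq_norm_toLp {α : Type*} [MeasurableSpace α] {μ : Measure α} {f : α → ℂ}
    (hf : MemLp f 2 μ) : ∫ x, ‖f x‖ ^ 2 ∂μ = ‖hf.toLp f‖ ^ 2 := by
  rw [← inner_self_eq_norm_sq (𝕜 := ℂ), L2.inner_def, ← integral_re (L2.integrable_inner _ _)]
  refine integral_congr_ae ?_
  filter_upwards [hf.coeFn_toLp] with x hx
  rw [hx, inner_self_eq_norm_sq]

theorem inner_toLp_toLp {α : Type*} [MeasurableSpace α] {μ : Measure α} {f g : α → ℂ}
    (hf : MemLp f 2 μ) (hg : MemLp g 2 μ) :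
    inner ℂ (hf.toLp f) (hg.toLp g) = ∫ x, starRingEnd ℂ (f x) * g x ∂μ := by
  rw [L2.inner_def]
  refine integral_congr_ae ?_
  filter_upwards [hf.coeFn_toLp, hg.coeFn_toLp] with x hx hy
  rw [hx, hy, RCLike.inner_apply, mul_comm]

/-- A bounded sequence in a Hilbert space converges weakly along some ultrafilter. -/
theorem exists_ultrafilter_tendsto_inner {H : Type*} [NormedAddCommGroup H]
    [InnerProductSpace ℂ H] [CompleteSpace H] (u : ℕ → H) (K : ℝ) (hu : ∀ n, ‖u n‖ ≤ K) :
    ∃ U : Ultrafilter ℕ, (U : Filter ℕ) ≤ atTop ∧ ∃ g : H, ∀ h : H,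
      Tendsto (fun n => inner ℂ (u n) h) U (𝓝 (inner ℂ g h)) := by
  refine ⟨hyperfilter ℕ, ?_, ?_⟩
  · rw [← Nat.cofinite_eq_atTop]; exact hyperfilter_le_cofinite
  -- Banach–Alaoglu, with the Hilbert space identified with its dual by the Riesz map.
  have hc := WeakDual.isCompact_closedBall (𝕜 := ℂ) (E := H) 0 K
  rw [isCompact_iff_ultrafilter_le_nhds] at hc
  obtain ⟨l, -, hl⟩ := hc ((hyperfilter ℕ).map
    fun n => StrongDual.toWeakDual (InnerProductSpace.toDual ℂ H (u n))) (by
      rw [Ultrafilter.coe_map, le_principal_iff, mem_map]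
      refine Filter.univ_mem' fun n => ?_
      simpa using hu n)
  refine ⟨(InnerProductSpace.toDual ℂ H).symm (WeakDual.toStrongDual l), fun h => ?_⟩
  have h2 : Tendsto (fun n => StrongDual.toWeakDual (InnerProductSpace.toDual ℂ H (u n)))
    (hyperfilter ℕ) (𝓝 l) := hl
  have h3 := ((WeakDual.eval_continuous h).tendsto l).comp h2
  rw [InnerProductSpace.toDual_symm_apply]
  exact h3

/-- Weak sequential compactness in `L²`, in terms of functions. -/
theorem exists_ultrafilter_tendsto_integral_mul {α : Type*} [MeasurableSpace α] {μ : Measure α}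
    (u : ℕ → α → ℂ) (hu : ∀ n, MemLp (u n) 2 μ) (K : ℝ)
    (hK : ∀ n, ∫ x, ‖u n x‖ ^ 2 ∂μ ≤ K) :
    ∃ U : Ultrafilter ℕ, (U : Filter ℕ) ≤ atTop ∧ ∃ g : α → ℂ, MemLp g 2 μ ∧
      ∀ h : α → ℂ, MemLp h 2 μ →
        Tendsto (fun n => ∫ x, h x * u n x ∂μ) U (𝓝 (∫ x, h x * g x ∂μ)) := by
  obtain ⟨U, hU, g, hg⟩ := exists_ultrafilter_tendsto_inner (fun n => (hu n).toLp (u n)) (√K)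
    (fun n => Real.le_sqrt_of_sq_le ((integral_norm_sq_eq_norm_toLp (hu n)).symm.trans_le (hK n)))
  refine ⟨U, hU, g, Lp.memLp g, fun h hh => ?_⟩
  -- The inner product is conjugate-linear in its first slot, where the sequence stands. Testing
  -- with the conjugate of `h` and conjugating the limit gives the bilinear pairing.
  have hs : MemLp (fun x => starRingEnd ℂ (h x)) 2 μ := hh.star
  have h1 := (Complex.continuous_conj.tendsto _).comp (hg (hs.toLp _))
  have e1 : (starRingEnd ℂ) (inner ℂ g (hs.toLp _)) = ∫ x, h x * g x ∂μ := by
    rw [inner_conj_symm]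
    conv_lhs => rw [← Lp.toLp_coeFn g (Lp.memLp g)]
    rw [inner_toLp_toLp]; simp
  rw [e1] at h1
  refine h1.congr fun n => ?_
  simp only [Function.comp]
  rw [inner_conj_symm, inner_toLp_toLp]; simp

/-! ### The `L²`-Hausdorff moment problem. -/

/-- The numbers `(n choose k) (-1)^(n-k) Δ^(n-k) a_k`. -/
noncomputable def hausdorffWeight (a : ℕ → ℂ) (n k : ℕ) : ℂ :=
  (n.choose k : ℂ) * ((-1) ^ (n - k) * ((fwdDiff (1 : ℕ))^[n - k] a) k)

/-- The linear functional on polynomials with prescribed moments. -/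
noncomputable def momentFunctional (a : ℕ → ℂ) : ℂ[X] →ₗ[ℂ] ℂ :=
  Polynomial.lsum fun n => LinearMap.mulRight ℂ (a n)

theorem momentFunctional_X_pow (a : ℕ → ℂ) (n : ℕ) : momentFunctional a (X ^ n) = a n := by
  simp [momentFunctional, ← Polynomial.monomial_one_right_eq_X_pow]

/-- Multiplying a polynomial by `1 - X` amounts to applying `-Δ` to the moments. -/
theorem momentFunctional_one_sub_X_pow (a : ℕ → ℂ) (i k : ℕ) :
    momentFunctional a ((1 - X) ^ i * X ^ k) = (-1) ^ i * ((fwdDiff (1 : ℕ))^[i] a) k := by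
  induction i generalizing k with
  | zero => simp [momentFunctional_X_pow]
  | succ i ih =>
    have : ((1 - X) ^ (i + 1) * X ^ k : ℂ[X]) =
        (1 - X) ^ i * X ^ k - (1 - X) ^ i * X ^ (k + 1) := by ring
    rw [this, map_sub, ih, ih, Function.iterate_succ_apply', fwdDiff]
    ring

/-- Since `(k choose j)(j+m choose k) = (j+m choose j)(m choose k-j)`, the factor `x^j` comes out
and the binomial expansion of `(x + (1 - x))^m = 1` remains. Applied to the moment functional, this
recovers `a_j` exactly from the discrete weights of every level `n ≥ j`. -/
theorem sum_choose_mul_bernstein {R : Type*} [CommRing R] (x : R) (j m : ℕ) :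
    ∑ k ∈ Finset.range (j + m + 1), ((k.choose j : R) * ((j + m).choose k : R)) *
      ((1 - x) ^ (j + m - k) * x ^ k) = ((j + m).choose j : R) * x ^ j := by
  rw [add_assoc, Finset.sum_range_add, Finset.sum_eq_zero, zero_add]
  · have h := (add_pow x (1 - x) m).symm
    rw [add_sub_cancel, one_pow] at h
    rw [← mul_one (_ * x ^ j)]
    conv_rhs => rw [← h, Finset.mul_sum]
    refine Finset.sum_congr rfl fun i hi => ?_
    have hi' : i ≤ m := Nat.lt_succ_iff.mp (Finset.mem_range.mp hi)
    have h2 : ((j + m).choose (j + i) : R) * ((j + i).choose j : R)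
        = ((j + m).choose j : R) * (m.choose i : R) := by
      have := Nat.choose_mul (n := j + m) (k := j + i) (s := j) (by omega)
      rw [Nat.add_sub_cancel_left, Nat.add_sub_cancel_left] at this
      rw [← Nat.cast_mul, this, Nat.cast_mul]
    rw [mul_comm ((j + i).choose j : R), h2, Nat.add_sub_add_left, pow_add]
    ring
  · intro k hk
    rw [Nat.choose_eq_zero_of_lt (Finset.mem_range.mp hk)]
    simp

theorem sum_choose_mul_hausdorffWeight (a : ℕ → ℂ) {j n : ℕ} (h : j ≤ n) :
    ∑ k ∈ Finset.range (n + 1), (k.choose j : ℂ) * hausdorffWeight a n k =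
      (n.choose j : ℂ) * a j := by
  obtain ⟨m, rfl⟩ := Nat.exists_eq_add_of_le h
  have := congrArg (momentFunctional a) (sum_choose_mul_bernstein (X : ℂ[X]) j m)
  rw [map_sum] at this
  have e : ∀ (c : ℕ) (p : ℂ[X]), momentFunctional a (c * p) = c * momentFunctional a p :=
    fun c p => by rw [← nsmul_eq_mul, map_nsmul, nsmul_eq_mul]
  simp only [mul_assoc, e, momentFunctional_X_pow, momentFunctional_one_sub_X_pow] at this
  rw [← this]
  refine Finset.sum_congr rfl fun k _ => ?_
  rw [hausdorffWeight]

/-- The step function on `[0, 1)` with value `G k` on `[k/N, (k+1)/N)`. -/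
noncomputable def stepFun {E : Type*} [Zero E] (N : ℕ) (G : ℕ → E) : ℝ → E :=
  (Set.Ico (0 : ℝ) 1).indicator fun x => G ⌊(N : ℝ) * x⌋₊

theorem stepFun_eq_sum {E : Type*} [AddCommMonoid E] {N : ℕ} (hN : 0 < N) (G : ℕ → E) :
    stepFun N G = fun x => ∑ k ∈ Finset.range N,
      (Set.Ico ((k : ℝ) / N) ((k + 1 : ℝ) / N)).indicator (fun _ => G k) x := by
  have hN' : (0 : ℝ) < N := by exact_mod_cast hN
  have key : ∀ (x : ℝ) (k : ℕ), 0 ≤ x →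
      (x ∈ Set.Ico ((k : ℝ) / N) ((k + 1 : ℝ) / N) ↔ ⌊(N : ℝ) * x⌋₊ = k) := by
    intro x k hx
    rw [Nat.floor_eq_iff (by positivity), Set.mem_Ico, div_le_iff₀ hN', lt_div_iff₀ hN',
      mul_comm x]
  funext x
  by_cases hx : x ∈ Set.Ico (0 : ℝ) 1
  · have hlt : ⌊(N : ℝ) * x⌋₊ < N := by
      rw [Nat.floor_lt (by have := hx.1; positivity)]
      nlinarith [hx.2]
    rw [stepFun, Set.indicator_of_mem hx, Finset.sum_eq_single_of_mem _ (Finset.mem_range.mpr hlt),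
      Set.indicator_of_mem ((key x _ hx.1).mpr rfl)]
    intro b _ hb
    rw [Set.indicator_of_notMem]
    rw [key x b hx.1]
    exact fun h => hb h.symm
  · rw [stepFun, Set.indicator_of_notMem hx, Finset.sum_eq_zero]
    intro k hk
    have hk' : ((k : ℝ) + 1) ≤ N := by exact_mod_cast Finset.mem_range.mp hk
    rw [Set.indicator_of_notMem]
    intro h
    refine hx ⟨le_trans (by positivity) h.1, h.2.trans_le ?_⟩
    rw [div_le_one hN']; exact hk'

theorem memLp_stepFun {E : Type*} [NormedAddCommGroup E] {N : ℕ} (hN : 0 < N) (G : ℕ → E)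
    (p : ENNReal) : MemLp (stepFun N G) p := by
  rw [stepFun_eq_sum hN]
  refine memLp_finsetSum _ fun k _ => memLp_indicator_const _ measurableSet_Ico _ (Or.inr ?_)
  simp

theorem integral_stepFun {E : Type*} [NormedAddCommGroup E] [NormedSpace ℝ E] [CompleteSpace E]
    {N : ℕ} (hN : 0 < N) (G : ℕ → E) :
    ∫ x, stepFun N G x = (1 / (N : ℝ)) • ∑ k ∈ Finset.range N, G k := by
  have hN' : (0 : ℝ) < N := by exact_mod_cast hN
  rw [stepFun_eq_sum hN, integral_finsetSum, Finset.smul_sum]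
  · refine Finset.sum_congr rfl fun k _ => ?_
    rw [integral_indicator_const _ measurableSet_Ico, Real.volume_real_Ico_of_le (by gcongr; simp)]
    congr 1; ring
  · intro k _
    exact (memLp_one_iff_integrable.mp (memLp_indicator_const 1 measurableSet_Ico _ (Or.inr (by simp))))

theorem norm_stepFun_sq {E : Type*} [NormedAddCommGroup E] (N : ℕ) (G : ℕ → E) (x : ℝ) :
    ‖stepFun N G x‖ ^ 2 = stepFun N (fun k => ‖G k‖ ^ 2) x := by
  by_cases hx : x ∈ Set.Ico (0 : ℝ) 1 <;> simp [stepFun, hx]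

theorem stepFun_mul (N : ℕ) (G H : ℕ → ℂ) (x : ℝ) :
    stepFun N G x * stepFun N H x = stepFun N (fun k => G k * H k) x := by
  by_cases hx : x ∈ Set.Ico (0 : ℝ) 1 <;> simp [stepFun, hx]

theorem tendsto_floor_sub_div (x : ℝ) (hx : 0 ≤ x) (i : ℕ) :
    Tendsto (fun n : ℕ => ((⌊((n + 1 : ℕ) : ℝ) * x⌋₊ : ℝ) - i) / ((n : ℝ) - i)) atTop (𝓝 x) := by
  have h1 : Tendsto (fun n : ℕ => (⌊x * ((n + 1 : ℕ) : ℝ)⌋₊ : ℝ) / ((n + 1 : ℕ) : ℝ)) atTop (𝓝 x) :=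
    (tendsto_nat_floor_mul_div_atTop hx).comp
      (tendsto_natCast_atTop_atTop.comp (tendsto_add_atTop_nat 1))
  have h0 : Tendsto (fun n : ℕ => ((n : ℝ))⁻¹) atTop (𝓝 0) := tendsto_inv_atTop_nhds_zero_nat
  have h2 : Tendsto (fun n : ℕ => (((n + 1 : ℕ) : ℝ))⁻¹) atTop (𝓝 0) :=
    h0.comp (tendsto_add_atTop_nat 1)
  have h3 : Tendsto (fun n : ℕ => ((⌊x * ((n + 1 : ℕ) : ℝ)⌋₊ : ℝ) / ((n + 1 : ℕ) : ℝ)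
      - i * (((n + 1 : ℕ) : ℝ))⁻¹) / (1 - (i + 1) * (((n + 1 : ℕ) : ℝ))⁻¹)) atTop
      (𝓝 ((x - i * 0) / (1 - (i + 1) * 0))) :=
    (h1.sub (h2.const_mul _)).div ((h2.const_mul _).const_sub _) (by simp)
  simp only [mul_zero, sub_zero, div_one] at h3
  refine h3.congr fun n => ?_
  have : ((n + 1 : ℕ) : ℝ) ≠ 0 := by positivity
  rw [mul_comm x, ← div_eq_mul_inv, ← sub_div, ← div_eq_mul_inv, one_sub_div this,
    div_div_div_cancel_right₀ this]
  push_cast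
  congr 1
  ring

/-- The quotient of binomials is a product of `j` quotients of linear factors, each tending to `x`.
It shows that the test functions reproducing `a_j` at level `n` approach `x^j`. -/
theorem tendsto_choose_floor_div (x : ℝ) (hx : 0 ≤ x) (j : ℕ) :
    Tendsto (fun n : ℕ => (((⌊((n + 1 : ℕ) : ℝ) * x⌋₊).choose j : ℝ) / (n.choose j : ℝ))) atTop
      (𝓝 (x ^ j)) := by
  have h := tendsto_finsetProd (Finset.range j) fun i _ => tendsto_floor_sub_div x hx i
  simp only [Finset.prod_const, Finset.card_range] at h
  refine h.congr fun n => ?_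
  have e : ∀ m : ℕ, (m.choose j : ℝ) = (∏ i ∈ Finset.range j, ((m : ℝ) - i)) / j.factorial := by
    intro m
    rw [Nat.cast_choose_eq_descPochhammer_div, descPochhammer_eval_eq_prod_range]
  rw [e, e, Finset.prod_div_distrib, div_div_div_cancel_right₀ (by positivity)]

/-- Strong convergence of one factor, paired with a bounded sequence, preserves the weak limit: the
error is bounded by Cauchy–Schwarz. -/
theorem tendsto_integral_mul_of_tendsto_sq {α : Type*} [MeasurableSpace α] {μ : Measure α}
    {l : Filter ℕ} {u h : ℕ → α → ℂ} {h0 : α → ℂ} {c : ℂ} {K : ℝ} (hu : ∀ n, MemLp (u n) 2 μ)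
    (hK : ∀ n, ∫ x, ‖u n x‖ ^ 2 ∂μ ≤ K) (hh : ∀ n, MemLp (h n) 2 μ) (hh0 : MemLp h0 2 μ)
    (hlim : Tendsto (fun n => ∫ x, ‖h n x - h0 x‖ ^ 2 ∂μ) l (𝓝 0))
    (hc : Tendsto (fun n => ∫ x, h0 x * u n x ∂μ) l (𝓝 c)) :
    Tendsto (fun n => ∫ x, h n x * u n x ∂μ) l (𝓝 c) := by
  have h1 : Tendsto (fun n => ∫ x, (h n x - h0 x) * u n x ∂μ) l (𝓝 0) := by
    rw [tendsto_zero_iff_norm_tendsto_zero]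
    have h2 : Tendsto (fun n => √((∫ x, ‖h n x - h0 x‖ ^ 2 ∂μ) * K)) l (𝓝 0) := by
      simpa using (hlim.mul_const K).sqrt
    refine squeeze_zero (fun n => norm_nonneg _) (fun n => ?_) h2
    refine Real.le_sqrt_of_sq_le ((norm_integral_mul_sq_le ((hh n).sub hh0) (hu n)).trans ?_)
    exact mul_le_mul_of_nonneg_left (hK n) (integral_nonneg fun x => by positivity)
  have := h1.add hc
  rw [zero_add] at this
  refine this.congr fun n => ?_
  rw [← integral_add]
  · exact integral_congr_ae (Eventually.of_forall fun x => by simp only; ring)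
  · exact (((hh n).sub hh0).integrable_mul (hu n))
  · exact hh0.integrable_mul (hu n)

/-- The `L²`-Hausdorff moment theorem. -/
theorem HausdorffL2.exists_moments {a : ℕ → ℂ} (ha : HausdorffL2 a) :
    ∃ φ : ℝ → ℂ, MemLp φ 2 ∧ (∀ x ∉ Set.Ioo (0 : ℝ) 1, φ x = 0) ∧
      ∀ n : ℕ, ∫ x : ℝ, (x : ℂ) ^ n * φ x = a n := by
  obtain ⟨M, -, hM⟩ := ha
  -- The `k`-th weight is spread evenly over an interval of length `1/(n+1)`. The squared norm of `u
  -- n` is then exactly the Hausdorff sum, read with `i = n - k`.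
  set u : ℕ → ℝ → ℂ := fun n => stepFun (n + 1) fun k => ((n : ℂ) + 1) * hausdorffWeight a n k
    with hu_def
  have hu : ∀ n, MemLp (u n) 2 := fun n => memLp_stepFun n.succ_pos _ _
  have hK : ∀ n, ∫ x, ‖u n x‖ ^ 2 ≤ M := by
    intro n
    simp only [hu_def, norm_stepFun_sq]
    rw [integral_stepFun n.succ_pos]
    refine le_trans (le_of_eq ?_) (hM n).le
    rw [← Finset.sum_range_reflect, smul_eq_mul, Finset.mul_sum, Finset.mul_sum]
    refine Finset.sum_congr rfl fun i hi => ?_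
    have hi' : i ≤ n := Nat.lt_succ_iff.mp (Finset.mem_range.mp hi)
    have e : n + 1 - 1 - i = n - i := by omega
    rw [e, hausdorffWeight, Nat.choose_symm hi', Nat.sub_sub_self hi']
    simp only [norm_mul, norm_pow, norm_neg, norm_one, one_pow, one_mul, Complex.norm_natCast]
    rw [show ‖(n : ℂ) + 1‖ = (n : ℝ) + 1 by exact_mod_cast Complex.norm_natCast (n + 1)]
    push_cast
    field_simp
  obtain ⟨U, hU, g, hg, hlim⟩ := exists_ultrafilter_tendsto_integral_mul u hu M hK
  refine ⟨(Set.Ioo (0 : ℝ) 1).indicator g, hg.indicator measurableSet_Ioo,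
    fun x hx => Set.indicator_of_notMem hx _, fun j => ?_⟩
  -- Against `q n` the density `u n` integrates to exactly `a j` once `n ≥ j`, while `q n` tends to
  -- `x^j` in `L²(0, 1)`.
  set q : ℕ → ℝ → ℂ := fun n => stepFun (n + 1) fun k => (k.choose j : ℂ) / (n.choose j : ℂ)
    with hq_def
  set q0 : ℝ → ℂ := (Set.Ico (0 : ℝ) 1).indicator fun x => (x : ℂ) ^ j with hq0_def
  have hq : ∀ n, MemLp (q n) 2 := fun n => memLp_stepFun n.succ_pos _ _
  have hq0m : AEStronglyMeasurable q0 :=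
    (by fun_prop : Continuous fun x : ℝ => (x : ℂ) ^ j).aestronglyMeasurable.indicator
      measurableSet_Ico
  have hone : MemLp ((Set.Ico (0 : ℝ) 1).indicator fun _ => (1 : ℝ)) 2 :=
    memLp_indicator_const _ measurableSet_Ico _ (Or.inr (by simp))
  have hq0 : MemLp q0 2 := by
    refine hone.of_le hq0m (Eventually.of_forall fun x => ?_)
    by_cases hx : x ∈ Set.Ico (0 : ℝ) 1
    · simp only [hq0_def, Set.indicator_of_mem hx, norm_pow, Complex.norm_real, norm_one]
      exact pow_le_one₀ (norm_nonneg _) (by rw [Real.norm_of_nonneg hx.1]; exact hx.2.le)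
    · simp [hq0_def, Set.indicator_of_notMem hx]
  have hexact : ∀ᶠ n in (U : Filter ℕ), ∫ x, q n x * u n x = a j := by
    refine Filter.Eventually.filter_mono hU ?_
    filter_upwards [eventually_ge_atTop j] with n hn
    simp only [hq_def, hu_def, stepFun_mul]
    rw [integral_stepFun n.succ_pos]
    have h1 : ((n.choose j : ℕ) : ℂ) ≠ 0 := by exact_mod_cast (Nat.choose_pos hn).ne'
    have h2 : (n : ℂ) + 1 ≠ 0 := by exact_mod_cast n.succ_ne_zero
    have := sum_choose_mul_hausdorffWeight a hn
    have e : ∑ k ∈ Finset.range (n + 1), (k.choose j : ℂ) / (n.choose j : ℂ) *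
        (((n : ℂ) + 1) * hausdorffWeight a n k) = ((n : ℂ) + 1) / (n.choose j : ℂ) *
        ∑ k ∈ Finset.range (n + 1), (k.choose j : ℂ) * hausdorffWeight a n k := by
      rw [Finset.mul_sum]
      exact Finset.sum_congr rfl fun k _ => by ring
    rw [e, this, Complex.real_smul]
    push_cast
    field_simp
  have hqlim : Tendsto (fun n => ∫ x, ‖q n x - q0 x‖ ^ 2) atTop (𝓝 0) := by
    have := tendsto_integral_of_dominated_convergence (μ := volume)
      (F := fun n x => ‖q n x - q0 x‖ ^ 2) (f := fun _ => (0 : ℝ))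
      ((Set.Ico (0 : ℝ) 1).indicator fun _ => (4 : ℝ))
      (fun n => (((hq n).sub hq0).aestronglyMeasurable.norm.pow 2))
      ((memLp_one_iff_integrable.mp (memLp_indicator_const 1 measurableSet_Ico _ (Or.inr (by simp)))))
      (fun n => Eventually.of_forall fun x => ?_) (Eventually.of_forall fun x => ?_)
    · simpa using this
    · by_cases hx : x ∈ Set.Ico (0 : ℝ) 1
      · simp only [hq_def, hq0_def, stepFun, Set.indicator_of_mem hx]
        have h1 : ‖(((⌊((n + 1 : ℕ) : ℝ) * x⌋₊).choose j : ℂ) / (n.choose j : ℂ))‖ ≤ 1 := by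
          rw [norm_div, Complex.norm_natCast, Complex.norm_natCast]
          refine div_le_one_of_le₀ ?_ (Nat.cast_nonneg _)
          have : ⌊((n + 1 : ℕ) : ℝ) * x⌋₊ ≤ n := by
            rw [← Nat.lt_succ_iff, Nat.floor_lt (by have := hx.1; positivity)]
            have : (0 : ℝ) < (n + 1 : ℕ) := by positivity
            push_cast at *
            nlinarith [hx.2]
          exact_mod_cast Nat.choose_le_choose j this
        have h2 : ‖(x : ℂ) ^ j‖ ≤ 1 := by
          rw [norm_pow, Complex.norm_real]
          exact pow_le_one₀ (norm_nonneg _) (by rw [Real.norm_of_nonneg hx.1]; exact hx.2.le)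
        have h3 := (norm_sub_le (((⌊((n + 1 : ℕ) : ℝ) * x⌋₊).choose j : ℂ) / (n.choose j : ℂ))
          ((x : ℂ) ^ j)).trans (add_le_add h1 h2)
        rw [norm_pow, norm_norm]
        calc _ ≤ (1 + 1 : ℝ) ^ 2 := by gcongr
          _ = 4 := by norm_num
      · simp [hq_def, hq0_def, stepFun, Set.indicator_of_notMem hx]
    · by_cases hx : x ∈ Set.Ico (0 : ℝ) 1
      · simp only [hq_def, hq0_def, stepFun, Set.indicator_of_mem hx]
        have h1 := (Complex.continuous_ofReal.tendsto _).comp (tendsto_choose_floor_div x hx.1 j)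
        have h2 : Tendsto (fun n : ℕ => (((⌊((n + 1 : ℕ) : ℝ) * x⌋₊).choose j : ℂ) /
            (n.choose j : ℂ)) - (x : ℂ) ^ j) atTop (𝓝 0) := by
          rw [← sub_self ((x : ℂ) ^ j)]
          refine Tendsto.sub_const ?_ _
          simpa [Function.comp_def] using h1
        simpa using h2.norm.pow 2
      · simp [hq_def, hq0_def, stepFun, Set.indicator_of_notMem hx]
  have h1 := tendsto_integral_mul_of_tendsto_sq hu hK hq hq0 (hqlim.mono_left hU) (hlim q0 hq0)
  have h2 : ∫ x, q0 x * g x = a j :=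
    tendsto_nhds_unique (h1.congr' hexact) tendsto_const_nhds
  rw [← h2]
  refine integral_congr_ae ?_
  -- The step functions live on `[0, 1)` and the density is cut off to `(0, 1)`; the difference is
  -- one point.
  have h0 : ∀ᵐ x : ℝ, x ≠ 0 := by simp [ae_iff]
  filter_upwards [h0] with x hx0
  by_cases hx : x ∈ Set.Ioo (0 : ℝ) 1
  · simp [hq0_def, hx, Set.Ioo_subset_Ico_self hx]
  · have : x ∉ Set.Ico (0 : ℝ) 1 := fun h => hx ⟨lt_of_le_of_ne h.1 (Ne.symm hx0), h.2⟩
    simp [hq0_def, hx, this]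

/-! ### Holomorphy of the Cauchy transform. -/

/-- The Cauchy transform of a function on the real line. -/
noncomputable def cauchyTransform (φ : ℝ → ℂ) (z : ℂ) : ℂ := ∫ t : ℝ, φ t / (z - t)

/-- Differentiation under the integral on the ball of radius `δ/2`, where the derivative of the
kernel is at most `4/δ²`. The distance is only needed where `φ` does not vanish, so real points off
the support are covered as well as points off the axis. -/
theorem differentiableAt_cauchyTransform {φ : ℝ → ℂ} (hφ : Integrable φ) {z : ℂ} {δ : ℝ}
    (hδ : 0 < δ) (h : ∀ t : ℝ, φ t ≠ 0 → δ ≤ ‖z - t‖) :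
    DifferentiableAt ℂ (cauchyTransform φ) z := by
  have hm : ∀ w : ℂ, AEStronglyMeasurable (fun t : ℝ => φ t / (w - t)) := fun w =>
    (hφ.aestronglyMeasurable.aemeasurable.div
      (by fun_prop : Measurable fun t : ℝ => w - t).aemeasurable).aestronglyMeasurable
  have hfar : ∀ w ∈ Metric.ball z (δ / 2), ∀ t : ℝ, φ t ≠ 0 → δ / 2 ≤ ‖w - t‖ := by
    intro w hw t ht
    have h1 := norm_sub_le_norm_sub_add_norm_sub z w t
    have h2 : ‖z - w‖ < δ / 2 := by rwa [← dist_eq_norm, dist_comm]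
    have h3 := h t ht
    linarith
  refine (hasDerivAt_integral_of_dominated_loc_of_deriv_le (μ := volume)
    (F := fun (w : ℂ) (t : ℝ) => φ t / (w - t)) (F' := fun w t => -φ t / (w - t) ^ 2)
    (bound := fun t => ‖φ t‖ * (4 / δ ^ 2)) (Metric.ball_mem_nhds z (half_pos hδ))
    (Eventually.of_forall hm) ?_ ?_ (Eventually.of_forall fun t w hw => ?_)
    (hφ.norm.mul_const _) (Eventually.of_forall fun t w hw => ?_)).2.differentiableAt
  · refine (hφ.norm.mul_const (1 / δ)).mono' (hm z) (Eventually.of_forall fun t => ?_)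
    by_cases ht : φ t = 0
    · simp [ht]
    · rw [norm_div, div_eq_mul_one_div]
      gcongr
      exact h t ht
  · exact (hφ.aestronglyMeasurable.aemeasurable.neg.div
      (by fun_prop : Measurable fun t : ℝ => (z - t) ^ 2).aemeasurable).aestronglyMeasurable
  · by_cases ht : φ t = 0
    · simp [ht]
    · rw [norm_div, norm_neg, norm_pow, div_eq_mul_one_div, show 4 / δ ^ 2 = 1 / (δ / 2) ^ 2 by
        field_simp; norm_num]
      gcongr
      exact hfar w hw t ht
  · by_cases ht : φ t = 0
    · simp only [ht, zero_div, neg_zero]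
      exact hasDerivAt_const _ _
    · have h0 : w - t ≠ 0 := norm_pos_iff.mp ((half_pos hδ).trans_le (hfar w hw t ht))
      have := (hasDerivAt_const w (φ t)).div ((hasDerivAt_id w).sub_const (t : ℂ)) h0
      rw [zero_mul, zero_sub, mul_one] at this
      exact this

theorem abs_im_le_norm_sub_ofReal (z : ℂ) (t : ℝ) : |z.im| ≤ ‖z - t‖ := by
  simpa using Complex.abs_im_le_norm (z - t)

theorem ofReal_sub_ne_zero {a : ℂ} (ha : a.im ≠ 0) (x : ℝ) : (x : ℂ) - a ≠ 0 := fun h => by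
  apply ha
  simpa using congrArg Complex.im h

theorem differentiableAt_cauchyTransform_of_im_ne_zero {φ : ℝ → ℂ} (hφ : Integrable φ) {z : ℂ}
    (hz : z.im ≠ 0) : DifferentiableAt ℂ (cauchyTransform φ) z :=
  differentiableAt_cauchyTransform hφ (abs_pos.mpr hz) fun t _ => abs_im_le_norm_sub_ofReal z t

/-! ### Integrals of Cauchy kernels over the real line. -/

theorem norm_inv_ofReal_sub_sq (a : ℂ) (x : ℝ) :
    ‖((x : ℂ) - a)⁻¹‖ ^ 2 = ((x - a.re) ^ 2 + a.im ^ 2)⁻¹ := by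
  rw [norm_inv, inv_pow, ← Complex.normSq_eq_norm_sq, Complex.normSq_apply]
  simp
  ring

theorem integrable_norm_inv_sq {a : ℂ} (ha : a.im ≠ 0) :
    Integrable (fun x : ℝ => ‖((x : ℂ) - a)⁻¹‖ ^ 2) ∧
      ∫ x : ℝ, ‖((x : ℂ) - a)⁻¹‖ ^ 2 = Real.pi / |a.im| := by
  have e : (fun x : ℝ => ‖((x : ℂ) - a)⁻¹‖ ^ 2) =
      fun x => (a.im ^ 2)⁻¹ * (1 + ((x - a.re) / a.im) ^ 2)⁻¹ := by
    funext x
    rw [norm_inv_ofReal_sub_sq, ← mul_inv, div_pow]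
    congr 1
    field_simp
    ring
  rw [e]
  constructor
  · exact ((integrable_inv_one_add_sq.comp_div ha).comp_sub_right a.re).const_mul _
  · rw [integral_const_mul,
      integral_sub_right_eq_self (fun x : ℝ => (1 + (x / a.im) ^ 2)⁻¹) a.re,
      Measure.integral_comp_div (fun x : ℝ => (1 + x ^ 2)⁻¹), integral_univ_inv_one_add_sq,
      smul_eq_mul, ← sq_abs a.im]
    have := abs_pos.mpr ha
    field_simp

theorem continuous_inv_ofReal_sub {a : ℂ} (ha : a.im ≠ 0) :
    Continuous fun x : ℝ => ((x : ℂ) - a)⁻¹ :=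
  Continuous.inv₀ (by fun_prop) (ofReal_sub_ne_zero ha)

theorem memLp_inv_ofReal_sub {a : ℂ} (ha : a.im ≠ 0) :
    MemLp (fun x : ℝ => ((x : ℂ) - a)⁻¹) 2 :=
  (memLp_two_iff_integrable_sq_norm (continuous_inv_ofReal_sub ha).aestronglyMeasurable).mpr
    (integrable_norm_inv_sq ha).1

theorem tendsto_log_add_sub_log (a : ℂ) :
    Tendsto (fun x : ℝ => Complex.log (x + a) - Real.log x) atTop (𝓝 0) := by
  have h1 : Tendsto (fun x : ℝ => Complex.log (1 + a * ((x⁻¹ : ℝ) : ℂ))) atTop (𝓝 0) := by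
    have h0 := (Complex.continuous_ofReal.tendsto 0).comp tendsto_inv_atTop_zero
    have h2 := (h0.const_mul a).const_add 1
    have h3 := (continuousAt_clog (x := 1) (by simp)).tendsto
    rw [Complex.log_one] at h3
    refine h3.comp ?_
    simpa using h2
  refine h1.congr' ?_
  have h4 : ∀ᶠ x : ℝ in atTop, ‖a‖ < x := eventually_gt_atTop _
  filter_upwards [h4, eventually_gt_atTop 0] with x hx hx0
  have hx0' : (x : ℂ) ≠ 0 := by exact_mod_cast hx0.ne'
  have e : (x : ℂ) + a = (x : ℝ) * (1 + a * ((x⁻¹ : ℝ) : ℂ)) := by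
    push_cast
    field_simp
  have hne : 1 + a * ((x⁻¹ : ℝ) : ℂ) ≠ 0 := by
    intro h
    rw [h, mul_zero] at e
    have : a = -x := by linear_combination e
    rw [this, norm_neg, Complex.norm_real, Real.norm_of_nonneg hx0.le] at hx
    exact lt_irrefl _ hx
  rw [e, Complex.log_ofReal_mul hx0 hne]
  ring

theorem log_neg_of_im_pos {w : ℂ} (h : 0 < w.im) :
    Complex.log (-w) = Complex.log w - Real.pi * Complex.I := by
  rw [Complex.log, Complex.log, norm_neg, Complex.arg_neg_eq_arg_sub_pi_of_im_pos h]
  push_cast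
  ring

theorem log_neg_of_im_neg {w : ℂ} (h : w.im < 0) :
    Complex.log (-w) = Complex.log w + Real.pi * Complex.I := by
  have := log_neg_of_im_pos (w := -w) (by simpa using h)
  rw [neg_neg] at this
  rw [this]
  ring

theorem tendsto_log_sub_atTop (a : ℂ) :
    Tendsto (fun x : ℝ => Complex.log (x - a) - Real.log x) atTop (𝓝 0) := by
  simpa [sub_eq_add_neg] using tendsto_log_add_sub_log (-a)

/-- For `Im a > 0` the point `x - a` lies below the axis, so its argument tends to `-π` as `x → -∞`.
`Real.log x` is `log |x|` and serves only to cancel the growth of the modulus. -/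
theorem tendsto_log_sub_atBot_of_im_pos {a : ℂ} (ha : 0 < a.im) :
    Tendsto (fun x : ℝ => Complex.log (x - a) - Real.log x) atBot (𝓝 (-(Real.pi * Complex.I))) := by
  have h := ((tendsto_log_add_sub_log a).comp tendsto_neg_atBot_atTop).sub_const
    (Real.pi * Complex.I)
  rw [zero_sub] at h
  refine h.congr fun x => ?_
  have e : (x : ℂ) - a = -((-x : ℝ) + a) := by push_cast; ring
  rw [e, log_neg_of_im_pos (by simpa using ha)]
  simp only [Function.comp, Real.log_neg_eq_log]
  ring

theorem tendsto_log_sub_atBot_of_im_neg {a : ℂ} (ha : a.im < 0) :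
    Tendsto (fun x : ℝ => Complex.log (x - a) - Real.log x) atBot (𝓝 (Real.pi * Complex.I)) := by
  have h := ((tendsto_log_add_sub_log a).comp tendsto_neg_atBot_atTop).add_const
    (Real.pi * Complex.I)
  rw [zero_add] at h
  refine h.congr fun x => ?_
  have e : (x : ℂ) - a = -((-x : ℝ) + a) := by push_cast; ring
  rw [e, log_neg_of_im_neg (by simpa using ha)]
  simp only [Function.comp, Real.log_neg_eq_log]
  ring

theorem hasDerivAt_log_sub {a : ℂ} (ha : a.im ≠ 0) (x : ℝ) :
    HasDerivAt (fun x : ℝ => Complex.log (x - a)) ((x : ℂ) - a)⁻¹ x := by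
  have h1 : HasDerivAt (fun x : ℝ => (x : ℂ) - a) 1 x :=
    Complex.ofRealCLM.hasDerivAt.sub_const a
  have h2 : (x : ℂ) - a ∈ Complex.slitPlane := by
    rw [Complex.mem_slitPlane_iff]
    right
    simpa using ha
  simpa using h1.clog_real h2

/-- Partial fractions give a difference of logarithms as antiderivative, and this plays the role of
a residue computation. At `+∞` the difference vanishes; at `-∞` only the arguments remain, which
tell whether the poles lie on the same side of the axis. -/
theorem integral_inv_mul_inv_of_tendsto {a b : ℂ} (ha : a.im ≠ 0) (hb : b.im ≠ 0) (hab : a ≠ b)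
    {la lb : ℂ} (hla : Tendsto (fun x : ℝ => Complex.log (x - a) - Real.log x) atBot (𝓝 la))
    (hlb : Tendsto (fun x : ℝ => Complex.log (x - b) - Real.log x) atBot (𝓝 lb)) :
    ∫ x : ℝ, ((x : ℂ) - a)⁻¹ * ((x : ℂ) - b)⁻¹ = (lb - la) / (a - b) := by
  have hab' : a - b ≠ 0 := sub_ne_zero.mpr hab
  have key := integral_of_hasDerivAt_of_tendsto
    (f := fun x : ℝ => (Complex.log (x - a) - Complex.log (x - b)) / (a - b))
    (f' := fun x : ℝ => ((x : ℂ) - a)⁻¹ * ((x : ℂ) - b)⁻¹) (m := (la - lb) / (a - b)) (n := 0)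
    (fun x => ?_) ((memLp_inv_ofReal_sub ha).integrable_mul (memLp_inv_ofReal_sub hb)) ?_ ?_
  · rw [key]; ring
  · convert! ((hasDerivAt_log_sub ha x).sub (hasDerivAt_log_sub hb x)).div_const (a - b) using 1
    have h1 := ofReal_sub_ne_zero ha x
    have h2 := ofReal_sub_ne_zero hb x
    field_simp
    ring
  · refine ((hla.sub hlb).div_const (a - b)).congr fun x => ?_
    ring
  · have := ((tendsto_log_sub_atTop a).sub (tendsto_log_sub_atTop b)).div_const (a - b)
    rw [sub_zero, zero_div] at this
    refine this.congr fun x => ?_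
    ring

theorem integral_inv_mul_inv_of_im_pos_of_im_neg {a b : ℂ} (ha : 0 < a.im) (hb : b.im < 0) :
    ∫ x : ℝ, ((x : ℂ) - a)⁻¹ * ((x : ℂ) - b)⁻¹ = 2 * Real.pi * Complex.I / (a - b) := by
  rw [integral_inv_mul_inv_of_tendsto ha.ne' hb.ne (fun h => by rw [h] at ha; linarith)
    (tendsto_log_sub_atBot_of_im_pos ha) (tendsto_log_sub_atBot_of_im_neg hb)]
  ring

theorem integral_inv_mul_inv_of_im_neg {a b : ℂ} (ha : a.im < 0) (hb : b.im < 0) (hab : a ≠ b) :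
    ∫ x : ℝ, ((x : ℂ) - a)⁻¹ * ((x : ℂ) - b)⁻¹ = 0 := by
  rw [integral_inv_mul_inv_of_tendsto ha.ne hb.ne hab
    (tendsto_log_sub_atBot_of_im_neg ha) (tendsto_log_sub_atBot_of_im_neg hb)]
  simp

/-! ### The Cauchy transform on horizontal lines. -/

theorem cauchyTransform_eq (φ : ℝ → ℂ) (x y : ℝ) :
    cauchyTransform φ (x + y * Complex.I) =
      ∫ t : ℝ, φ t * ((x : ℂ) - ((t : ℂ) - y * Complex.I))⁻¹ := by
  refine integral_congr_ae (Eventually.of_forall fun t => ?_)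
  simp only [div_eq_mul_inv]
  congr 2
  ring

theorem continuous_cauchyTransform_line {φ : ℝ → ℂ} (hφ : Integrable φ) {y : ℝ} (hy : 0 < y) :
    Continuous fun x : ℝ => cauchyTransform φ (x + y * Complex.I) := by
  rw [continuous_iff_continuousAt]
  intro x
  have h1 : ContinuousAt (cauchyTransform φ) (x + y * Complex.I) :=
    (differentiableAt_cauchyTransform_of_im_ne_zero hφ (by simpa using hy.ne')).continuousAt
  exact ContinuousAt.comp (f := fun x : ℝ => (x : ℂ) + y * Complex.I) h1
    (by fun_prop)

theorem aestronglyMeasurable_prod_kernel {φ h : ℝ → ℂ} (hφ : AEStronglyMeasurable φ)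
    (hh : AEStronglyMeasurable h) (y : ℝ) :
    AEStronglyMeasurable (fun p : ℝ × ℝ =>
      h p.1 * (φ p.2 * ((p.1 : ℂ) - ((p.2 : ℂ) - y * Complex.I))⁻¹)) (volume.prod volume) := by
  refine hh.comp_fst.mul (hφ.comp_snd.mul ?_)
  exact (by fun_prop : Measurable fun p : ℝ × ℝ =>
    ((p.1 : ℂ) - ((p.2 : ℂ) - y * Complex.I))⁻¹).aestronglyMeasurable

/-- Cauchy–Schwarz with respect to the weight `‖φ‖`, then Tonelli. The bound blows up as `y → 0`,
but it supplies the finiteness on which the uniform bound relies. -/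
theorem memLp_cauchyTransform_line {φ : ℝ → ℂ} (hφ : Integrable φ) {y : ℝ} (hy : 0 < y) :
    MemLp (fun x : ℝ => cauchyTransform φ (x + y * Complex.I)) 2 ∧
      ∫ x : ℝ, ‖cauchyTransform φ (x + y * Complex.I)‖ ^ 2 ≤
        (∫ t, ‖φ t‖) ^ 2 * (Real.pi / y) := by
  set k : ℝ → ℝ → ℂ := fun x t => ((x : ℂ) - ((t : ℂ) - y * Complex.I))⁻¹ with hk
  have him : ∀ t : ℝ, ((t : ℂ) - y * Complex.I).im = -y := fun t => by simp
  have hk1 : ∀ t, Integrable (fun x => ‖k x t‖ ^ 2) ∧ ∫ x, ‖k x t‖ ^ 2 = Real.pi / y := by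
    intro t
    have := integrable_norm_inv_sq (a := (t : ℂ) - y * Complex.I) (by rw [him]; simpa using hy.ne')
    rw [him, abs_neg, abs_of_pos hy] at this
    exact this
  have hkb : ∀ x t, ‖k x t‖ ≤ 1 / y := by
    intro x t
    rw [hk]
    simp only [norm_inv, one_div]
    gcongr
    have := Complex.abs_im_le_norm ((x : ℂ) - ((t : ℂ) - y * Complex.I))
    simpa [abs_of_pos hy] using this
  have hkm : Measurable fun p : ℝ × ℝ => k p.1 p.2 := by fun_prop
  have hG : Integrable (fun p : ℝ × ℝ => ‖φ p.2‖ * ‖k p.1 p.2‖ ^ 2) (volume.prod volume) := by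
    refine (integrable_prod_iff' (hφ.aestronglyMeasurable.comp_snd.norm.mul
      (hkm.norm.pow_const 2).aestronglyMeasurable)).mpr ⟨Eventually.of_forall fun t => (hk1 t).1.const_mul ‖φ t‖, ?_⟩
    simp only [Pi.mul_apply, norm_mul, norm_norm, norm_pow, integral_const_mul, (hk1 _).2]
    exact hφ.norm.mul_const _
  have hG1 := hG.integral_prod_left
  have hG2 : ∫ x, ∫ t, ‖φ t‖ * ‖k x t‖ ^ 2 = (∫ t, ‖φ t‖) * (Real.pi / y) := by
    rw [integral_integral_swap (f := fun x t => ‖φ t‖ * ‖k x t‖ ^ 2) hG]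
    simp only [integral_const_mul, (hk1 _).2, integral_mul_const]
  have hsq : ∀ x : ℝ, ‖cauchyTransform φ (x + y * Complex.I)‖ ^ 2 ≤
      (∫ t, ‖φ t‖) * ∫ t, ‖φ t‖ * ‖k x t‖ ^ 2 := by
    intro x
    rw [cauchyTransform_eq]
    have hm0 : AEStronglyMeasurable (fun t => ((√‖φ t‖ : ℝ) : ℂ)) :=
      Complex.continuous_ofReal.comp_aestronglyMeasurable
        (Real.continuous_sqrt.comp_aestronglyMeasurable hφ.aestronglyMeasurable.norm)
    have hn0 : ∀ t, ‖((√‖φ t‖ : ℝ) : ℂ)‖ ^ 2 = ‖φ t‖ := fun t => by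
      rw [Complex.norm_real, Real.norm_of_nonneg (Real.sqrt_nonneg _),
        Real.sq_sqrt (norm_nonneg _)]
    have hkx : Measurable fun t => k x t := by fun_prop
    have h1 : MemLp (fun t => ((√‖φ t‖ : ℝ) : ℂ)) 2 :=
      (memLp_two_iff_integrable_sq_norm hm0).mpr (by simpa only [hn0] using hφ.norm)
    have hn1 : ∀ t, ‖((√‖φ t‖ * ‖k x t‖ : ℝ) : ℂ)‖ ^ 2 = ‖φ t‖ * ‖k x t‖ ^ 2 := fun t => by
      rw [Complex.ofReal_mul, norm_mul, mul_pow, hn0, Complex.norm_real, norm_norm]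
    have h2 : MemLp (fun t => ((√‖φ t‖ * ‖k x t‖ : ℝ) : ℂ)) 2 := by
      have hm1 : AEStronglyMeasurable (fun t => ((√‖φ t‖ * ‖k x t‖ : ℝ) : ℂ)) := by
        simp only [Complex.ofReal_mul]
        exact hm0.mul (Complex.continuous_ofReal.comp_aestronglyMeasurable
          hkx.norm.aestronglyMeasurable)
      rw [memLp_two_iff_integrable_sq_norm hm1]
      simp only [hn1]
      refine (hφ.norm.mul_const ((1 / y) ^ 2)).mono' (hφ.aestronglyMeasurable.norm.mul
        (hkx.norm.pow_const 2).aestronglyMeasurable) (Eventually.of_forall fun t => ?_)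
      rw [norm_mul, norm_norm, norm_pow, norm_norm]
      gcongr
      exact hkb x t
    have h3 := norm_integral_mul_sq_le h1 h2
    simp only [hn0, hn1] at h3
    refine le_trans ?_ h3
    have h4 : ‖∫ t, φ t * k x t‖ ≤ ∫ t, ‖φ t‖ * ‖k x t‖ :=
      (norm_integral_le_integral_norm _).trans (by simp)
    have h5 : (∫ t, ((√‖φ t‖ : ℝ) : ℂ) * ((√‖φ t‖ * ‖k x t‖ : ℝ) : ℂ)) =
        ((∫ t, ‖φ t‖ * ‖k x t‖ : ℝ) : ℂ) := by
      rw [← integral_complex_ofReal]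
      refine integral_congr_ae (Eventually.of_forall fun t => ?_)
      simp only
      rw [← Complex.ofReal_mul, ← mul_assoc, Real.mul_self_sqrt (norm_nonneg _)]
    rw [h5, Complex.norm_real, Real.norm_of_nonneg (integral_nonneg fun t => by positivity)]
    gcongr
  have hint : Integrable fun x : ℝ => ‖cauchyTransform φ (x + y * Complex.I)‖ ^ 2 := by
    refine (hG1.const_mul (∫ t, ‖φ t‖)).mono'
      ((continuous_cauchyTransform_line hφ hy).norm.pow 2).aestronglyMeasurable
      (Eventually.of_forall fun x => ?_)
    rw [norm_pow, norm_norm]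
    exact hsq x
  refine ⟨(memLp_two_iff_integrable_sq_norm
    (continuous_cauchyTransform_line hφ hy).aestronglyMeasurable).mpr hint, ?_⟩
  refine (integral_mono hint (hG1.const_mul (∫ t, ‖φ t‖)) hsq).trans (le_of_eq ?_)
  rw [integral_const_mul, hG2]
  ring

/-- Fubini applies because Cauchy–Schwarz bounds the integral in `x` of `‖h‖` times the kernel
uniformly in `t`, and `φ` is integrable. -/
theorem integral_mul_cauchyTransform {φ h : ℝ → ℂ} (hφ : Integrable φ) (hh : MemLp h 2)
    {y : ℝ} (hy : 0 < y) :
    ∫ x : ℝ, h x * cauchyTransform φ (x + y * Complex.I) =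
      ∫ t : ℝ, φ t * ∫ x : ℝ, h x * ((x : ℂ) - ((t : ℂ) - y * Complex.I))⁻¹ := by
  have him : ∀ t : ℝ, ((t : ℂ) - y * Complex.I).im = -y := fun t => by simp
  have hne : ∀ t : ℝ, ((t : ℂ) - y * Complex.I).im ≠ 0 := fun t => by
    rw [him]; simpa using hy.ne'
  have hm := aestronglyMeasurable_prod_kernel hφ.aestronglyMeasurable hh.aestronglyMeasurable y
  have hF : Integrable (Function.uncurry fun x t : ℝ =>
      h x * (φ t * ((x : ℂ) - ((t : ℂ) - y * Complex.I))⁻¹)) (volume.prod volume) := by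
    refine (integrable_prod_iff' hm).mpr ⟨Eventually.of_forall fun t => ?_, ?_⟩
    · refine ((hh.integrable_mul (memLp_inv_ofReal_sub (hne t))).const_mul (φ t)).congr
        (Eventually.of_forall fun x => ?_)
      simp only [Pi.mul_apply]
      ring
    · refine (hφ.norm.mul_const (√((∫ x, ‖h x‖ ^ 2) * (Real.pi / y)))).mono'
        hm.norm.prod_swap.integral_prod_right' (Eventually.of_forall fun t => ?_)
      rw [Real.norm_of_nonneg (integral_nonneg fun x => norm_nonneg _)]
      simp only [norm_mul]
      have e : ∀ x : ℝ, ‖h x‖ * (‖φ t‖ * ‖((x : ℂ) - ((t : ℂ) - y * Complex.I))⁻¹‖) =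
        ‖φ t‖ * (‖h x‖ * ‖((x : ℂ) - ((t : ℂ) - y * Complex.I))⁻¹‖) := fun x => by ring
      simp only [e, integral_const_mul]
      gcongr
      refine Real.le_sqrt_of_sq_le ?_
      have h1 := norm_integral_mul_sq_le (f := fun x => ((‖h x‖ : ℝ) : ℂ))
        (g := fun x : ℝ => ((‖((x : ℂ) - ((t : ℂ) - y * Complex.I))⁻¹‖ : ℝ) : ℂ))
        hh.norm.ofReal (memLp_inv_ofReal_sub (hne t)).norm.ofReal
      simp only [← Complex.ofReal_mul, integral_complex_ofReal, Complex.norm_real, norm_norm]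
        at h1
      rw [(integrable_norm_inv_sq (hne t)).2, him, abs_neg, abs_of_pos hy,
        Real.norm_of_nonneg (integral_nonneg fun x => by positivity)] at h1
      exact h1
  calc _ = ∫ x : ℝ, ∫ t : ℝ, h x * (φ t * ((x : ℂ) - ((t : ℂ) - y * Complex.I))⁻¹) := by
        refine integral_congr_ae (Eventually.of_forall fun x => ?_)
        simp only [integral_const_mul, cauchyTransform_eq]
    _ = _ := by
        rw [integral_integral_swap hF]
        refine integral_congr_ae (Eventually.of_forall fun t => ?_)
        simp only
        rw [← integral_const_mul]
        refine integral_congr_ae (Eventually.of_forall fun x => ?_)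
        simp only
        ring

/-- After Fubini the two poles `ζ` and `t - iy` lie on opposite sides of the axis, so a Cauchy
formula results. -/
theorem integral_inv_mul_cauchyTransform {φ : ℝ → ℂ} (hφ : Integrable φ) {ζ : ℂ}
    (hζ : 0 < ζ.im) {y : ℝ} (hy : 0 < y) :
    ∫ x : ℝ, ((x : ℂ) - ζ)⁻¹ * cauchyTransform φ (x + y * Complex.I) =
      2 * Real.pi * Complex.I * cauchyTransform φ (ζ + y * Complex.I) := by
  rw [integral_mul_cauchyTransform hφ (memLp_inv_ofReal_sub hζ.ne') hy, cauchyTransform,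
    ← integral_const_mul]
  refine integral_congr_ae (Eventually.of_forall fun t => ?_)
  simp only
  rw [integral_inv_mul_inv_of_im_pos_of_im_neg hζ (by simpa using hy)]
  rw [show ζ - (t - y * Complex.I) = ζ + y * Complex.I - t by ring]
  ring

/-- Both poles now lie below the axis and nothing is left. The condition `ζ.im < -y` keeps `ζ` away
from every `t - iy`. -/
theorem integral_inv_mul_cauchyTransform_of_im_lt {φ : ℝ → ℂ} (hφ : Integrable φ) {ζ : ℂ}
    {y : ℝ} (hy : 0 < y) (hζ : ζ.im < -y) :
    ∫ x : ℝ, ((x : ℂ) - ζ)⁻¹ * cauchyTransform φ (x + y * Complex.I) = 0 := by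
  have h0 : ζ.im < 0 := by linarith
  rw [integral_mul_cauchyTransform hφ (memLp_inv_ofReal_sub h0.ne) hy]
  refine integral_eq_zero_of_ae (Eventually.of_forall fun t => ?_)
  simp only [Pi.zero_apply]
  rw [integral_inv_mul_inv_of_im_neg h0 (by simpa using hy) ?_, mul_zero]
  intro h
  rw [h] at hζ
  simp at hζ

/-- The Cauchy transform of an `L²` function is uniformly square integrable on the lines
parallel to the real axis. -/
theorem integral_norm_cauchyTransform_sq_le {φ : ℝ → ℂ} (hφ : Integrable φ) (hφ2 : MemLp φ 2)
    {y : ℝ} (hy : 0 < y) :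
    ∫ x : ℝ, ‖cauchyTransform φ (x + y * Complex.I)‖ ^ 2 ≤
      (2 * Real.pi) ^ 2 * ∫ t, ‖φ t‖ ^ 2 := by
  set Q : ℝ → ℝ := fun y => ∫ x : ℝ, ‖cauchyTransform φ (x + y * Complex.I)‖ ^ 2 with hQ
  set A : ℝ := (2 * Real.pi) ^ 2 * ∫ t, ‖φ t‖ ^ 2 with hA
  have hA0 : 0 ≤ A := mul_nonneg (by positivity) (integral_nonneg fun x => by positivity)
  have hQ0 : ∀ y, 0 ≤ Q y := fun y => integral_nonneg fun x => by positivity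
  -- `Q y` is the pairing of the transform with its own conjugate. Fubini moves one factor onto `φ`,
  -- the reproducing formula turns the other into the transform at height `2y`, and Cauchy–Schwarz
  -- closes the estimate.
  have hstep : ∀ y, 0 < y → Q y ^ 2 ≤ A * Q (2 * y) := by
    intro y hy
    have hmem := (memLp_cauchyTransform_line hφ hy).1
    have e1 : ((Q y : ℝ) : ℂ) = ∫ x : ℝ,
        starRingEnd ℂ (cauchyTransform φ (x + y * Complex.I)) *
          cauchyTransform φ (x + y * Complex.I) := by
      rw [hQ, ← integral_complex_ofReal]
      refine integral_congr_ae (Eventually.of_forall fun x => ?_)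
      simp only
      rw [← Complex.normSq_eq_conj_mul_self, Complex.normSq_eq_norm_sq]
    have e2 : ∀ t : ℝ, ∫ x : ℝ, starRingEnd ℂ (cauchyTransform φ (x + y * Complex.I)) *
        ((x : ℂ) - ((t : ℂ) - y * Complex.I))⁻¹ = starRingEnd ℂ (2 * Real.pi * Complex.I *
          cauchyTransform φ (t + (2 * y : ℝ) * Complex.I)) := by
      intro t
      have h1 := integral_inv_mul_cauchyTransform hφ (ζ := t + y * Complex.I) (by simpa using hy) hy
      rw [show (t : ℂ) + (2 * y : ℝ) * Complex.I = t + y * Complex.I + y * Complex.I by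
        push_cast; ring, ← h1, ← integral_conj]
      refine integral_congr_ae (Eventually.of_forall fun x => ?_)
      simp only [map_mul, map_inv₀, map_sub, map_add, Complex.conj_ofReal, Complex.conj_I]
      rw [mul_comm]
      congr 2
      ring
    have e3 : ((Q y : ℝ) : ℂ) = ∫ t : ℝ, φ t * starRingEnd ℂ (2 * Real.pi * Complex.I *
          cauchyTransform φ (t + (2 * y : ℝ) * Complex.I)) := by
      rw [e1]
      refine (integral_mul_cauchyTransform hφ hmem.star hy).trans ?_
      refine integral_congr_ae (Eventually.of_forall fun t => ?_)
      simp only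
      rw [← e2]
      rfl
    have h2y : 0 < 2 * y := by linarith
    have h3 : ‖((Q y : ℝ) : ℂ)‖ ^ 2 ≤ (∫ t, ‖φ t‖ ^ 2) * ∫ t : ℝ, ‖starRingEnd ℂ (2 * Real.pi *
        Complex.I * cauchyTransform φ (t + (2 * y : ℝ) * Complex.I))‖ ^ 2 := by
      rw [e3]
      exact norm_integral_mul_sq_le hφ2
        (((memLp_cauchyTransform_line hφ h2y).1.const_mul (2 * Real.pi * Complex.I)).star)
    have h4 : ∫ t : ℝ, ‖starRingEnd ℂ (2 * Real.pi *
        Complex.I * cauchyTransform φ (t + (2 * y : ℝ) * Complex.I))‖ ^ 2 =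
        (2 * Real.pi) ^ 2 * Q (2 * y) := by
      rw [hQ, ← integral_const_mul]
      refine integral_congr_ae (Eventually.of_forall fun t => ?_)
      simp [mul_pow, abs_of_pos Real.pi_pos]
    rw [h4, Complex.norm_real, Real.norm_of_nonneg (hQ0 y)] at h3
    refine h3.trans (le_of_eq ?_)
    ring
  set D : ℝ := (∫ t, ‖φ t‖) ^ 2 * (Real.pi / y) with hD
  have hbdd : BddAbove (Q '' Set.Ici y) := by
    refine ⟨D, ?_⟩
    rintro _ ⟨y', hy', rfl⟩
    have hy'' : y ≤ y' := hy'
    refine (memLp_cauchyTransform_line hφ (hy.trans_le hy'')).2.trans ?_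
    rw [hD]
    gcongr
  set S := sSup (Q '' Set.Ici y) with hS
  have hle : ∀ y', y ≤ y' → Q y' ≤ S := fun y' h => le_csSup hbdd ⟨y', h, rfl⟩
  have hS0 : 0 ≤ S := (hQ0 y).trans (hle y le_rfl)
  -- The half-line of heights at least `y` is stable under doubling, so the supremum `S` satisfies
  -- `S² ≤ A S`. As `S` is finite by the crude bound, `S ≤ A`, and no trace of `y` remains.
  have hS1 : S ≤ √(A * S) := by
    refine csSup_le ⟨_, y, Set.self_mem_Ici, rfl⟩ ?_
    rintro _ ⟨y', hy', rfl⟩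
    have hy'' : y ≤ y' := hy'
    refine Real.le_sqrt_of_sq_le ((hstep y' (hy.trans_le hy'')).trans ?_)
    exact mul_le_mul_of_nonneg_left (hle _ (by linarith)) hA0
  have hS2 : S ^ 2 ≤ A * S := by
    rw [← Real.sq_sqrt (mul_nonneg hA0 hS0)]
    gcongr
  refine (hle y le_rfl).trans ?_
  rcases hS0.eq_or_lt with h | h
  · rw [← h]; exact hA0
  · nlinarith

/-! ### Poisson integrals and boundary values. -/

/-- The Poisson kernel of the upper half-plane. -/
noncomputable def halfPlanePoisson (ζ : ℂ) (x : ℝ) : ℝ :=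
  ζ.im / (Real.pi * ((x - ζ.re) ^ 2 + ζ.im ^ 2))

/-- The splitting into Cauchy kernels at conjugate points lets the two pole computations above be
used: one kernel reproduces the Cauchy transform, the other annihilates it. -/
theorem ofReal_halfPlanePoisson {ζ : ℂ} (hζ : ζ.im ≠ 0) (x : ℝ) :
    (halfPlanePoisson ζ x : ℂ) =
      (2 * Real.pi * Complex.I)⁻¹ * (((x : ℂ) - ζ)⁻¹ - ((x : ℂ) - starRingEnd ℂ ζ)⁻¹) := by
  have h1 := ofReal_sub_ne_zero hζ x
  have h2 : (x : ℂ) - starRingEnd ℂ ζ ≠ 0 := ofReal_sub_ne_zero (by simpa using hζ) x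
  have e1 : ((x : ℂ) - ζ) * ((x : ℂ) - starRingEnd ℂ ζ) =
      (((x - ζ.re) ^ 2 + ζ.im ^ 2 : ℝ) : ℂ) := by
    apply Complex.ext
    · rw [Complex.ofReal_re]; simp [Complex.mul_re]; ring
    · rw [Complex.ofReal_im]; simp [Complex.mul_im]; ring
  have e2 : ζ - starRingEnd ℂ ζ = 2 * ζ.im * Complex.I := by
    rw [Complex.sub_conj]; push_cast; ring
  rw [inv_sub_inv h1 h2, e1, show (x : ℂ) - starRingEnd ℂ ζ - (x - ζ) = ζ - starRingEnd ℂ ζ by ring,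
    e2, halfPlanePoisson]
  have hpi : (Real.pi : ℂ) ≠ 0 := by exact_mod_cast Real.pi_ne_zero
  have hD : (((x - ζ.re) ^ 2 + ζ.im ^ 2 : ℝ) : ℂ) ≠ 0 := by rw [← e1]; exact mul_ne_zero h1 h2
  push_cast at hD ⊢
  have hI := Complex.I_ne_zero
  field_simp

/-- The Cauchy transform in the upper half-plane is the Poisson integral of an `L²` function. -/
theorem exists_cauchyTransform_eq_poisson {φ : ℝ → ℂ} (hφ : Integrable φ) (hφ2 : MemLp φ 2) :
    ∃ g : ℝ → ℂ, MemLp g 2 ∧ ∀ ζ : ℂ, 0 < ζ.im →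
      ∫ x, (halfPlanePoisson ζ x : ℂ) * g x = cauchyTransform φ ζ := by
  have hpos : ∀ n : ℕ, (0 : ℝ) < 1 / ((n : ℝ) + 1) := fun n => by positivity
  -- `g` is a weak limit of the traces on the lines at height `1/(n+1)`, bounded by the uniform
  -- estimate.
  obtain ⟨U, hU, g, hg, hlim⟩ := exists_ultrafilter_tendsto_integral_mul
    (fun (n : ℕ) (x : ℝ) => cauchyTransform φ (x + (1 / ((n : ℝ) + 1) : ℝ) * Complex.I))
    (fun n => (memLp_cauchyTransform_line hφ (hpos n)).1) _
    (fun n => integral_norm_cauchyTransform_sq_le hφ hφ2 (hpos n))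
  refine ⟨g, hg, fun ζ hζ => ?_⟩
  have hζ' : (starRingEnd ℂ ζ).im ≠ 0 := by simpa using hζ.ne'
  have hP : MemLp (fun x => (halfPlanePoisson ζ x : ℂ)) 2 := by
    simp only [ofReal_halfPlanePoisson hζ.ne']
    exact ((memLp_inv_ofReal_sub hζ.ne').sub (memLp_inv_ofReal_sub hζ')).const_mul _
  refine tendsto_nhds_unique (hlim _ hP) ?_
  have h0 : Tendsto (fun n : ℕ => 1 / ((n : ℝ) + 1)) atTop (𝓝 0) :=
    tendsto_one_div_add_atTop_nhds_zero_nat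
  have h1 : Tendsto (fun n : ℕ => ζ + (1 / ((n : ℝ) + 1) : ℝ) * Complex.I) atTop (𝓝 ζ) := by
    have := (((Complex.continuous_ofReal.tendsto 0).comp h0).mul_const Complex.I).const_add ζ
    simpa using this
  have h2 := ((differentiableAt_cauchyTransform_of_im_ne_zero hφ
    hζ.ne').continuousAt.tendsto.comp h1).mono_left hU
  refine h2.congr' (Filter.Eventually.filter_mono hU ?_)
  -- The line must be lower than `ζ` is high, so that the kernel with pole at the conjugate of `ζ`
  -- contributes zero.
  filter_upwards [h0.eventually_lt_const hζ] with n hn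
  have hmem := (memLp_cauchyTransform_line hφ (hpos n)).1
  simp only [ofReal_halfPlanePoisson hζ.ne', mul_assoc, sub_mul, Function.comp]
  have hsub := integral_sub ((memLp_inv_ofReal_sub hζ.ne').integrable_mul hmem)
    ((memLp_inv_ofReal_sub hζ').integrable_mul hmem)
  simp only [Pi.mul_apply] at hsub
  rw [integral_const_mul, hsub,
    integral_inv_mul_cauchyTransform hφ hζ (hpos n),
    integral_inv_mul_cauchyTransform_of_im_lt hφ (hpos n) (by simpa using hn), sub_zero]
  have hpi : (Real.pi : ℂ) ≠ 0 := by exact_mod_cast Real.pi_ne_zero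
  have hI := Complex.I_ne_zero
  field_simp

theorem enorm_ofReal_of_nonneg {r : ℝ} (h : 0 ≤ r) : ‖(r : ℂ)‖ₑ = ENNReal.ofReal r := by
  rw [← ofReal_norm, Complex.norm_real, Real.norm_of_nonneg h]

theorem halfPlanePoisson_eq (ζ : ℂ) (x : ℝ) :
    halfPlanePoisson ζ x = ζ.im / Real.pi * ‖((x : ℂ) - ζ)⁻¹‖ ^ 2 := by
  rw [halfPlanePoisson, norm_inv_ofReal_sub_sq, div_mul_eq_div_div, div_eq_mul_inv (_ / Real.pi)]

theorem halfPlanePoisson_nonneg {ζ : ℂ} (hζ : 0 < ζ.im) (x : ℝ) : 0 ≤ halfPlanePoisson ζ x := by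
  rw [halfPlanePoisson]; positivity

theorem integrable_halfPlanePoisson {ζ : ℂ} (hζ : 0 < ζ.im) :
    Integrable (halfPlanePoisson ζ) := by
  have := (integrable_norm_inv_sq hζ.ne').1.const_mul (ζ.im / Real.pi)
  exact this.congr (Eventually.of_forall fun x => (halfPlanePoisson_eq ζ x).symm)

theorem integral_halfPlanePoisson {ζ : ℂ} (hζ : 0 < ζ.im) : ∫ x, halfPlanePoisson ζ x = 1 := by
  simp only [halfPlanePoisson_eq, integral_const_mul, (integrable_norm_inv_sq hζ.ne').2,
    abs_of_pos hζ]
  have := Real.pi_pos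
  field_simp

theorem memLp_halfPlanePoisson {ζ : ℂ} (hζ : 0 < ζ.im) :
    MemLp (fun x => (halfPlanePoisson ζ x : ℂ)) 2 := by
  simp only [ofReal_halfPlanePoisson hζ.ne']
  exact ((memLp_inv_ofReal_sub hζ.ne').sub
    (memLp_inv_ofReal_sub (a := starRingEnd ℂ ζ) (by simpa using hζ.ne'))).const_mul _

/-- Layer cake: the superlevel set at `t` lies in the ball of radius `√(y/t)` and is empty for `t >
1/y`, while the integral of `c √(y/t)` over `(0, 1/y]` is `2c`. The bound does not depend on `y`, so
a Lebesgue point controls the Poisson integral at every small height. -/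
theorem lintegral_poisson_le_of_measure_closedBall_le {ν : Measure ℝ} {s c : ℝ}
    (hν : ∀ r > 0, ν (Metric.closedBall s r) ≤ ENNReal.ofReal (c * r)) (hc : 0 ≤ c) {y : ℝ}
    (hy : 0 < y) :
    ∫⁻ x, ENNReal.ofReal (y / ((x - s) ^ 2 + y ^ 2)) ∂ν ≤ ENNReal.ofReal (2 * c) := by
  have hcont : Measurable fun x : ℝ => y / ((x - s) ^ 2 + y ^ 2) := by fun_prop
  rw [lintegral_eq_lintegral_meas_le ν (Eventually.of_forall fun x => by positivity)
    hcont.aemeasurable]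
  have hbound : ∀ t ∈ Set.Ioi (0 : ℝ), ν {x | t ≤ y / ((x - s) ^ 2 + y ^ 2)} ≤
      (Set.Ioc 0 (1 / y)).indicator (fun t => ENNReal.ofReal (c * √y * t ^ (-(1 / 2) : ℝ))) t := by
    intro t ht
    have ht : 0 < t := ht
    have hiff : ∀ x, t ≤ y / ((x - s) ^ 2 + y ^ 2) → t * ((x - s) ^ 2 + y ^ 2) ≤ y := fun x hx => by
      rwa [le_div_iff₀ (by positivity)] at hx
    by_cases ht1 : t ≤ 1 / y
    · have hmem : t ∈ Set.Ioc 0 (1 / y) := ⟨ht, ht1⟩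
      rw [Set.indicator_of_mem hmem]
      have e : √y * t ^ (-(1 / 2) : ℝ) = √(y / t) := by
        rw [Real.rpow_neg ht.le, ← Real.sqrt_eq_rpow, Real.sqrt_div hy.le, div_eq_mul_inv]
      rw [mul_assoc, e]
      refine le_trans (measure_mono fun x hx => ?_) (hν _ (Real.sqrt_pos.mpr (div_pos hy ht)))
      rw [Metric.mem_closedBall, Real.dist_eq]
      refine Real.le_sqrt_of_sq_le ?_
      rw [sq_abs, le_div_iff₀ ht]
      nlinarith [hiff x hx, mul_nonneg ht.le (sq_nonneg y)]
    · have : {x : ℝ | t ≤ y / ((x - s) ^ 2 + y ^ 2)} = ∅ := by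
        rw [Set.eq_empty_iff_forall_notMem]
        intro x hx
        have h1 := hiff x hx
        rw [not_le, div_lt_iff₀ hy] at ht1
        nlinarith [mul_nonneg ht.le (sq_nonneg (x - s))]
      rw [this, measure_empty]
      exact zero_le
  refine (setLIntegral_mono' measurableSet_Ioi hbound).trans ?_
  rw [lintegral_indicator measurableSet_Ioc, Measure.restrict_restrict measurableSet_Ioc,
    Set.inter_eq_left.mpr (fun t ht => ht.1)]
  have hy1 : (0 : ℝ) ≤ 1 / y := by positivity
  have hint : IntegrableOn (fun t : ℝ => c * √y * t ^ (-(1 / 2) : ℝ)) (Set.Ioc 0 (1 / y)) := by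
    rw [← intervalIntegrable_iff_integrableOn_Ioc_of_le hy1]
    exact (intervalIntegral.intervalIntegrable_rpow' (by norm_num)).const_mul _
  rw [← ofReal_integral_eq_lintegral_ofReal hint]
  · refine ENNReal.ofReal_le_ofReal (le_of_eq ?_)
    rw [← intervalIntegral.integral_of_le hy1, intervalIntegral.integral_const_mul,
      integral_rpow (Or.inl (by norm_num))]
    norm_num
    rw [← Real.sqrt_eq_rpow, Real.sqrt_inv]
    have : √y ≠ 0 := (Real.sqrt_pos.mpr hy).ne'
    field_simp
  · refine (ae_restrict_mem measurableSet_Ioc).mono fun t ht => ?_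
    have := ht.1
    positivity

/-- Inside the cone `(x - s)² ≤ 2(x - ζ.re)² + 2 ζ.im²`, whence the factor `3`; the `π` in the
denominator is discarded. This reduces nontangential to vertical approach. -/
theorem halfPlanePoisson_le_three_mul {ζ : ℂ} {s : ℝ} (hζ : 0 < ζ.im) (h : |ζ.re - s| ≤ ζ.im)
    (x : ℝ) : halfPlanePoisson ζ x ≤ 3 * (ζ.im / ((x - s) ^ 2 + ζ.im ^ 2)) := by
  have h1 : (ζ.re - s) ^ 2 ≤ ζ.im ^ 2 := sq_le_sq' (by linarith [abs_le.mp h]) (abs_le.mp h).2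
  have h2 : (x - s) ^ 2 + ζ.im ^ 2 ≤ 3 * ((x - ζ.re) ^ 2 + ζ.im ^ 2) := by
    nlinarith [sq_nonneg ((x - ζ.re) - (ζ.re - s))]
  rw [halfPlanePoisson, ← mul_div_assoc, div_le_div_iff₀ (by positivity) (by positivity)]
  have hpi : 1 ≤ Real.pi := by linarith [Real.pi_gt_three]
  have h3 : (0:ℝ) ≤ (x - ζ.re) ^ 2 + ζ.im ^ 2 := by positivity
  calc ζ.im * ((x - s) ^ 2 + ζ.im ^ 2) ≤ ζ.im * (3 * ((x - ζ.re) ^ 2 + ζ.im ^ 2)) := by gcongr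
    _ ≤ ζ.im * (3 * (Real.pi * ((x - ζ.re) ^ 2 + ζ.im ^ 2))) := by
        gcongr
        nlinarith
    _ = _ := by ring

/-- Nontangential convergence of the Poisson integral of an `L²` function almost everywhere. -/
theorem ae_tendsto_integral_halfPlanePoisson {g : ℝ → ℂ} (hg : MemLp g 2) :
    ∀ᵐ s : ℝ, ∀ (l : Filter ℝ) (ζ : ℝ → ℂ), Tendsto (fun i => (ζ i).im) l (𝓝 0) →
      (∀ᶠ i in l, 0 < (ζ i).im) → (∀ᶠ i in l, |(ζ i).re - s| ≤ (ζ i).im) →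
      Tendsto (fun i => ∫ x, (halfPlanePoisson (ζ i) x : ℂ) * g x) l (𝓝 (g s)) := by
  have hloc : LocallyIntegrable g := hg.locallyIntegrable (by norm_num)
  -- The exceptional set is the complement of the Lebesgue points of `g`, and hence independent of
  -- the approach path.
  filter_upwards [IsUnifLocDoublingMeasure.ae_tendsto_average_norm_sub volume hloc 1] with s hs
  intro l ζ hlim hpos hcone
  have havg := hs (l := 𝓝[>] (0 : ℝ)) (fun _ => s) id tendsto_id
    (eventually_mem_nhdsWithin.mono fun r hr => by
      simp only [id, one_mul]; exact Metric.mem_closedBall_self (le_of_lt hr))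
  simp only [id] at havg
  set G : ℝ → ENNReal := fun x => ‖g x - g s‖ₑ with hG
  have hdm : AEStronglyMeasurable (fun x => g x - g s) :=
    hg.aestronglyMeasurable.sub aestronglyMeasurable_const
  have hGm : AEMeasurable G := hdm.enorm
  -- the tail is integrable against the Poisson kernel
  have hK : ∃ K : ℝ, 0 ≤ K ∧ ∫⁻ x, ENNReal.ofReal (1 / ((x - s) ^ 2 + 1)) * G x =
      ENNReal.ofReal K := by
    have hI : (0 : ℝ) < ((s : ℂ) + Complex.I).im := by simp
    have h1 : Integrable fun x => (halfPlanePoisson (s + Complex.I) x : ℂ) * (g x - g s) := by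
      have := ((memLp_halfPlanePoisson hI).integrable_mul hg).sub
        ((integrable_halfPlanePoisson hI).ofReal.mul_const (g s))
      refine this.congr (Eventually.of_forall fun x => ?_)
      simp only [Pi.sub_apply, Pi.mul_apply]
      exact (mul_sub _ _ _).symm
    have h2 := (h1.const_mul (Real.pi : ℂ)).hasFiniteIntegral
    have h3 : ∫⁻ x, ENNReal.ofReal (1 / ((x - s) ^ 2 + 1)) * G x < ⊤ := by
      refine lt_of_eq_of_lt (lintegral_congr fun x => ?_) h2
      simp only
      rw [← mul_assoc, enorm_mul, ← Complex.ofReal_mul, enorm_ofReal_of_nonneg (mul_nonneg Real.pi_pos.le (halfPlanePoisson_nonneg hI x))]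
      congr 2
      simp only [halfPlanePoisson, Complex.add_re, Complex.ofReal_re, Complex.I_re, add_zero,
        Complex.add_im, Complex.ofReal_im, Complex.I_im, zero_add, one_pow]
      have := Real.pi_pos
      field_simp
    exact ⟨_, ENNReal.toReal_nonneg, (ENNReal.ofReal_toReal h3.ne).symm⟩
  obtain ⟨K, hK0, hK⟩ := hK
  rw [Metric.tendsto_nhds]
  intro ε hε
  -- The final bound is `3 (4η + y C K)`, with `4η = ε/6` and `y C K < ε/12`, so it stays below
  -- `3ε/4`.
  set η : ℝ := ε / 24 with hη_def
  have hη : 0 < η := by positivity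
  obtain ⟨δ, hδ, hδη⟩ : ∃ δ > 0, ∀ r, 0 < r → r ≤ δ →
      (⨍ x in Metric.closedBall s r, ‖g x - g s‖) ≤ η := by
    have := (havg.eventually_le_const hη)
    rw [eventually_nhdsWithin_iff, Metric.eventually_nhds_iff] at this
    obtain ⟨δ, hδ, h⟩ := this
    refine ⟨δ / 2, by positivity, fun r hr hr' => h ?_ hr⟩
    rw [Real.dist_eq, sub_zero, abs_of_pos hr]
    linarith
  -- Near `s` the measure `‖g - g s‖ dx` gives balls of radius `r` mass at most `2ηr`, as the ball
  -- has length `2r`. Truncation to radius `δ` makes this hold for all `r`.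
  set ν : Measure ℝ := (volume.restrict (Metric.closedBall s δ)).withDensity G with hν_def
  have hball : ∀ r, 0 < r → r ≤ δ → ∫⁻ x in Metric.closedBall s r, G x ≤
      ENNReal.ofReal (2 * η * r) := by
    intro r hr hrδ
    have hint : IntegrableOn (fun x => g x - g s) (Metric.closedBall s r) :=
      (hloc.sub (locallyIntegrable_const (g s))).integrableOn_isCompact
        (isCompact_closedBall s r)
    rw [← ofReal_integral_norm_eq_lintegral_enorm hint]
    refine ENNReal.ofReal_le_ofReal ?_
    have h := hδη r hr hrδ
    rw [setAverage_eq, measureReal_def, Real.volume_closedBall, smul_eq_mul,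
      ENNReal.toReal_ofReal (by positivity), inv_mul_le_iff₀ (by positivity)] at h
    linarith
  have hν : ∀ r > 0, ν (Metric.closedBall s r) ≤ ENNReal.ofReal (2 * η * r) := by
    intro r hr
    rw [hν_def, withDensity_apply _ Metric.isClosed_closedBall.measurableSet,
      Measure.restrict_restrict Metric.isClosed_closedBall.measurableSet]
    rcases le_total r δ with h | h
    · rw [Set.inter_eq_left.mpr (Metric.closedBall_subset_closedBall h)]
      exact hball r hr h
    · rw [Set.inter_eq_right.mpr (Metric.closedBall_subset_closedBall h)]
      refine (hball δ hδ le_rfl).trans (ENNReal.ofReal_le_ofReal ?_)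
      gcongr
  -- For `|x - s| > δ` one has `(x - s)² + 1 ≤ C (x - s)²`, so the tail is at most `y C` times a
  -- fixed finite integral.
  set C : ℝ := 1 + 1 / δ ^ 2 with hC_def
  have hC : 0 < C := by positivity
  have hsmall : ∀ᶠ i in l, (ζ i).im * (C * K) < ε / 12 := by
    have := hlim.mul_const (C * K)
    rw [zero_mul] at this
    exact this.eventually_lt_const (by positivity)
  filter_upwards [hpos, hcone, hsmall] with i hi hi2 hi3
  set y := (ζ i).im with hy_def
  set p : ℝ → ENNReal := fun x => ENNReal.ofReal (y / ((x - s) ^ 2 + y ^ 2)) with hp_def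
  have hpm : Measurable p := by fun_prop
  have hnear : ∫⁻ x in Metric.closedBall s δ, p x * G x ≤ ENNReal.ofReal (4 * η) := by
    have h := lintegral_poisson_le_of_measure_closedBall_le hν (by positivity) hi
    rw [hν_def, lintegral_withDensity_eq_lintegral_mul_non_measurable₀ _ hGm.restrict
      (Eventually.of_forall fun x => by simp [hG])] at h
    refine le_trans (le_of_eq ?_) (h.trans (ENNReal.ofReal_le_ofReal (by linarith)))
    exact lintegral_congr fun x => mul_comm _ _
  have hfar : ∫⁻ x in (Metric.closedBall s δ)ᶜ, p x * G x ≤ ENNReal.ofReal (y * (C * K)) := by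
    have hb : ∀ x ∈ (Metric.closedBall s δ)ᶜ, p x * G x ≤
        ENNReal.ofReal (y * C) * (ENNReal.ofReal (1 / ((x - s) ^ 2 + 1)) * G x) := by
      intro x hx
      rw [← mul_assoc, ← ENNReal.ofReal_mul (by positivity)]
      refine mul_le_mul_left (ENNReal.ofReal_le_ofReal ?_) _
      rw [mul_one_div, div_le_div_iff₀ (by positivity) (by positivity), mul_assoc]
      gcongr
      rw [Set.mem_compl_iff, Metric.mem_closedBall, not_le, Real.dist_eq] at hx
      have hx2 : δ ^ 2 ≤ (x - s) ^ 2 := by rw [← sq_abs (x - s)]; gcongr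
      have : 1 ≤ 1 / δ ^ 2 * (x - s) ^ 2 := by
        rw [one_div, inv_mul_eq_div, one_le_div (by positivity)]; exact hx2
      rw [hC_def]
      nlinarith [mul_nonneg hC.le (sq_nonneg y)]
    refine (setLIntegral_mono' Metric.isClosed_closedBall.measurableSet.compl hb).trans ?_
    refine (setLIntegral_le_lintegral _ _).trans (le_of_eq ?_)
    rw [lintegral_const_mul' _ _ ENNReal.ofReal_ne_top, hK, ← ENNReal.ofReal_mul (by positivity),
      mul_assoc]
  have hPr : Integrable fun x => (halfPlanePoisson (ζ i) x : ℂ) :=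
    (integrable_halfPlanePoisson hi).ofReal
  have hdiff : (∫ x, (halfPlanePoisson (ζ i) x : ℂ) * g x) - g s =
      ∫ x, (halfPlanePoisson (ζ i) x : ℂ) * (g x - g s) := by
    have h1 := integral_sub ((memLp_halfPlanePoisson hi).integrable_mul hg) (hPr.mul_const (g s))
    simp only [Pi.mul_apply, integral_mul_const] at h1
    rw [integral_complex_ofReal, integral_halfPlanePoisson hi, Complex.ofReal_one, one_mul] at h1
    rw [← h1]
    exact integral_congr_ae (Eventually.of_forall fun x => (mul_sub _ _ _).symm)
  have hmain : ‖∫ x, (halfPlanePoisson (ζ i) x : ℂ) * (g x - g s)‖ₑ ≤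
      ENNReal.ofReal (3 * (4 * η + y * (C * K))) := by
    refine (enorm_integral_le_lintegral_enorm _).trans ?_
    calc _ ≤ ∫⁻ x, ENNReal.ofReal 3 * (p x * G x) := by
          refine lintegral_mono fun x => ?_
          rw [enorm_mul, ← mul_assoc, hp_def, ← ENNReal.ofReal_mul (by norm_num),
            enorm_ofReal_of_nonneg (halfPlanePoisson_nonneg hi x)]
          exact mul_le_mul_left
            (ENNReal.ofReal_le_ofReal (halfPlanePoisson_le_three_mul hi hi2 x)) _
      _ ≤ ENNReal.ofReal 3 * (ENNReal.ofReal (4 * η) + ENNReal.ofReal (y * (C * K))) := by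
          rw [lintegral_const_mul' _ _ ENNReal.ofReal_ne_top,
            ← lintegral_add_compl _ (Metric.isClosed_closedBall (x := s) (ε := δ)).measurableSet]
          gcongr
      _ = _ := by
          rw [← ENNReal.ofReal_add (by positivity) (by positivity),
            ← ENNReal.ofReal_mul (by norm_num)]
  rw [dist_eq_norm, hdiff]
  rw [← ofReal_norm, ENNReal.ofReal_le_ofReal_iff (by positivity)] at hmain
  linarith

/-- This is the Plemelj jump before passing to the limit. With it the boundary values from below
follow from those from above. -/
theorem cauchyTransform_sub_conj {φ : ℝ → ℂ} (hφ : MemLp φ 2) {ζ : ℂ}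
    (hζ : 0 < ζ.im) :
    cauchyTransform φ ζ - cauchyTransform φ (starRingEnd ℂ ζ) =
      -(2 * Real.pi * Complex.I) * ∫ t, (halfPlanePoisson ζ t : ℂ) * φ t := by
  have hζ' : (starRingEnd ℂ ζ).im ≠ 0 := by simpa using hζ.ne'
  have hint : ∀ z : ℂ, z.im ≠ 0 → Integrable fun t : ℝ => φ t / (z - t) := by
    intro z hz
    refine (hφ.integrable_mul (memLp_inv_ofReal_sub hz)).neg.congr (Eventually.of_forall fun t => ?_)
    simp only [Pi.neg_apply, Pi.mul_apply]
    rw [← mul_neg, ← inv_neg, neg_sub, div_eq_mul_inv]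
  rw [cauchyTransform, cauchyTransform, ← integral_sub (hint _ hζ.ne') (hint _ hζ'),
    ← integral_const_mul]
  refine integral_congr_ae (Eventually.of_forall fun t => ?_)
  simp only
  rw [ofReal_halfPlanePoisson hζ.ne', ← neg_sub (t : ℂ) ζ, ← neg_sub (t : ℂ) (starRingEnd ℂ ζ)]
  have hpi := Complex.two_pi_I_ne_zero
  have h1 := ofReal_sub_ne_zero hζ.ne' t
  have h2 := ofReal_sub_ne_zero hζ' t
  field_simp
  ring

/-- The Cauchy transform of an `L²` function has nontangential boundary values from above and from
below almost everywhere, and they differ by a multiple of the function. -/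
theorem exists_ae_tendsto_cauchyTransform {φ : ℝ → ℂ} (hφ : MemLp φ 2) (hφ1 : Integrable φ) :
    ∃ g : ℝ → ℂ, ∀ᵐ s : ℝ, ∀ (l : Filter ℝ) (ζ : ℝ → ℂ), Tendsto (fun i => (ζ i).im) l (𝓝 0) →
      (∀ᶠ i in l, 0 < (ζ i).im) → (∀ᶠ i in l, |(ζ i).re - s| ≤ (ζ i).im) →
      Tendsto (fun i => cauchyTransform φ (ζ i)) l (𝓝 (g s)) ∧
      Tendsto (fun i => cauchyTransform φ (starRingEnd ℂ (ζ i))) l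
        (𝓝 (g s + 2 * Real.pi * Complex.I * φ s)) := by
  obtain ⟨g, hg, hgC⟩ := exists_cauchyTransform_eq_poisson hφ1 hφ
  refine ⟨g, ?_⟩
  filter_upwards [ae_tendsto_integral_halfPlanePoisson hg,
    ae_tendsto_integral_halfPlanePoisson hφ] with s h1 h2 l ζ hlim hpos hcone
  have e1 : Tendsto (fun i => cauchyTransform φ (ζ i)) l (𝓝 (g s)) := by
    refine (h1 l ζ hlim hpos hcone).congr' ?_
    filter_upwards [hpos] with i hi using hgC _ hi
  refine ⟨e1, ?_⟩
  refine (e1.add ((h2 l ζ hlim hpos hcone).const_mul (2 * Real.pi * Complex.I))).congr' ?_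
  filter_upwards [hpos] with i hi
  linear_combination cauchyTransform_sub_conj hφ hi

/-! ### The extension to the cut plane and its jump. -/

/-- The holomorphic extension of `(1/2π) ∑ a_n e^{-inθ}`, where `a_n` are the moments of `φ`. -/
noncomputable def trigExtension (φ : ℝ → ℂ) (θ : ℂ) : ℂ :=
  1 / (2 * (Real.pi : ℂ)) * (Complex.exp (Complex.I * θ) *
    cauchyTransform φ (Complex.exp (Complex.I * θ)))

/-- The point `0` is included for free because the exponential never vanishes; this makes the
excluded set compact. -/
theorem mem_cutDomain_iff (θ : ℂ) :
    θ ∈ cutDomain ↔ Complex.exp (Complex.I * θ) ∉ Complex.ofReal '' Set.Icc (0 : ℝ) 1 := by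
  rw [cutDomain, Set.mem_ofPred_eq, not_iff_not]
  constructor
  · rintro ⟨k, v, hv, rfl⟩
    refine ⟨Real.exp (-v), ⟨(Real.exp_pos _).le, Real.exp_le_one_iff.mpr (by linarith)⟩, ?_⟩
    rw [Complex.ofReal_exp, mul_add, Complex.exp_add,
      show Complex.I * (2 * Real.pi * k) = k * (2 * Real.pi * Complex.I) by ring,
      Complex.exp_int_mul_two_pi_mul_I, one_mul, ← mul_assoc, Complex.I_mul_I]
    push_cast
    ring_nf
  · rintro ⟨x, ⟨hx0, hx1⟩, hx⟩
    have hxpos : 0 < x := lt_of_le_of_ne hx0 fun h => Complex.exp_ne_zero (Complex.I * θ) (by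
      rw [← hx, ← h, Complex.ofReal_zero])
    rw [← Real.exp_log hxpos, Complex.ofReal_exp, eq_comm, Complex.exp_eq_exp_iff_exists_int] at hx
    obtain ⟨k, hk⟩ := hx
    refine ⟨k, -Real.log x, neg_nonneg.mpr (Real.log_nonpos hx0 hx1), ?_⟩
    have h2 : θ = -Complex.I * (Complex.I * θ) := by
      rw [← mul_assoc, neg_mul, Complex.I_mul_I]; ring
    rw [h2, hk]
    push_cast
    linear_combination (-(k : ℂ) * (2 * Real.pi)) * Complex.I_mul_I

theorem isClosed_ofReal_image_Icc : IsClosed (Complex.ofReal '' Set.Icc (0 : ℝ) 1) :=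
  (isCompact_Icc.image Complex.continuous_ofReal).isClosed

theorem isOpen_cutDomain : IsOpen cutDomain := by
  have : cutDomain = (fun θ : ℂ => Complex.exp (Complex.I * θ)) ⁻¹'
      (Complex.ofReal '' Set.Icc (0 : ℝ) 1)ᶜ := Set.ext fun θ => mem_cutDomain_iff θ
  rw [this]
  exact isClosed_ofReal_image_Icc.isOpen_compl.preimage (by fun_prop)

theorem mem_cutDomain_of_im_neg {θ : ℂ} (h : θ.im < 0) : θ ∈ cutDomain := by
  rintro ⟨k, v, hv, rfl⟩
  simp at h
  linarith

/-- The cuts run upwards, so the vertical ray going down from any point of the domain avoids them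
and reaches the lower half-plane, which is convex. -/
theorem isPreconnected_cutDomain : IsPreconnected cutDomain := by
  refine isPreconnected_of_forall (-Complex.I) fun y hy => ?_
  refine ⟨{z | z.im < 0} ∪ {z | z.re = y.re ∧ z.im ≤ y.im}, ?_, ?_, ?_, ?_⟩
  · refine Set.union_subset (fun z hz => mem_cutDomain_of_im_neg hz) ?_
    rintro z ⟨h1, h2⟩ ⟨k, v, hv, rfl⟩
    refine hy ⟨k, y.im, ?_, ?_⟩
    · refine hv.trans ?_
      simpa using h2
    · apply Complex.ext
      · simpa using h1.symm
      · simp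
  · left; simp
  · right; exact ⟨rfl, le_rfl⟩
  · refine IsPreconnected.union (⟨y.re, min y.im (-1)⟩ : ℂ) ?_ ?_ ?_ ?_
    · simp
    · exact ⟨rfl, min_le_left _ _⟩
    · exact (convex_halfSpace_im_lt 0).isPreconnected
    · have : {z : ℂ | z.re = y.re ∧ z.im ≤ y.im} = {z : ℂ | z.re = y.re} ∩ {z | z.im ≤ y.im} := rfl
      rw [this]
      exact ((convex_hyperplane Complex.reLm.isLinear y.re).inter
        (convex_halfSpace_im_le y.im)).isPreconnected

/-- By the identity theorem, the boundary behaviour found for one explicit extension holds for all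
of them. -/
theorem IsHolomorphicExtension.eqOn {a : ℕ → ℂ} {f f' : ℂ → ℂ} (hf : IsHolomorphicExtension a f)
    (hf' : IsHolomorphicExtension a f') : Set.EqOn f f' cutDomain := by
  refine (hf.1.analyticOnNhd isOpen_cutDomain).eqOn_of_preconnected_of_eventuallyEq
    (hf'.1.analyticOnNhd isOpen_cutDomain) isPreconnected_cutDomain
    (mem_cutDomain_of_im_neg (θ := -Complex.I) (by simp)) ?_
  have : {z : ℂ | z.im < 0} ∈ 𝓝 (-Complex.I) :=
    (isOpen_lt Complex.continuous_im continuous_const).mem_nhds (by simp)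
  filter_upwards [this] with θ hθ
  exact (hf.2 θ hθ).unique (hf'.2 θ hθ)

/-- With `w = e^{-iθ}`, of modulus less than one for `Im θ < 0`, one has `e^{iθ}/(e^{iθ} - t) = ∑ wⁿ
tⁿ` for `t` in the support, and termwise integration produces the moments. -/
theorem isHolomorphicExtension_trigExtension {a : ℕ → ℂ} {φ : ℝ → ℂ} (hφ : Integrable φ)
    (hsupp : ∀ x ∉ Set.Ioo (0 : ℝ) 1, φ x = 0)
    (ha : ∀ n : ℕ, ∫ x : ℝ, (x : ℂ) ^ n * φ x = a n) :
    IsHolomorphicExtension a (trigExtension φ) := by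
  have hmem : ∀ t, φ t ≠ 0 → t ∈ Set.Icc (0 : ℝ) 1 := fun t ht =>
    Set.Ioo_subset_Icc_self (by_contra fun h => ht (hsupp t h))
  constructor
  · intro θ hθ
    rw [mem_cutDomain_iff] at hθ
    have hne : (Complex.ofReal '' Set.Icc (0 : ℝ) 1).Nonempty := ⟨0, 0, by simp, by simp⟩
    have hd := (isClosed_ofReal_image_Icc.notMem_iff_infDist_pos hne).mp hθ
    have hC : DifferentiableAt ℂ (cauchyTransform φ) (Complex.exp (Complex.I * θ)) := by
      refine differentiableAt_cauchyTransform hφ hd fun t ht => ?_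
      rw [← dist_eq_norm]
      exact Metric.infDist_le_dist_of_mem ⟨t, hmem t ht, rfl⟩
    have hE : DifferentiableAt ℂ (fun θ : ℂ => Complex.exp (Complex.I * θ)) θ := by fun_prop
    exact ((hE.mul (DifferentiableAt.comp θ hC hE)).const_mul _).differentiableWithinAt
  · intro θ hθ
    refine HasSum.mul_left _ ?_
    set w : ℂ := Complex.exp (-(Complex.I * θ)) with hw
    have hw1 : ‖w‖ < 1 := by
      rw [hw, Complex.norm_exp, Real.exp_lt_one_iff]
      simpa using hθ
    have hwe : w * Complex.exp (Complex.I * θ) = 1 := by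
      rw [hw, ← Complex.exp_add, neg_add_cancel, Complex.exp_zero]
    set F : ℕ → ℝ → ℂ := fun n t => w ^ n * ((t : ℂ) ^ n * φ t) with hF
    have hbound : ∀ n t, ‖F n t‖ ≤ ‖w‖ ^ n * ‖φ t‖ := by
      intro n t
      by_cases ht : φ t = 0
      · simp [hF, ht]
      · have h1 := hmem t ht
        rw [hF]
        simp only [norm_mul, norm_pow, Complex.norm_real, Real.norm_of_nonneg h1.1]
        gcongr
        exact mul_le_of_le_one_left (norm_nonneg _) (pow_le_one₀ h1.1 h1.2)
    have hFm : ∀ n, AEStronglyMeasurable (F n) := fun n =>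
      ((by fun_prop : Continuous fun t : ℝ => (t : ℂ) ^ n).aestronglyMeasurable.mul
        hφ.aestronglyMeasurable).const_mul _
    have hFi : ∀ n, Integrable (F n) := fun n =>
      (hφ.norm.const_mul (‖w‖ ^ n)).mono' (hFm n) (Eventually.of_forall (hbound n))
    have hsum : Summable fun n => ∫ t, ‖F n t‖ := by
      refine Summable.of_nonneg_of_le (fun n => integral_nonneg fun t => norm_nonneg _) (fun n => ?_)
        ((summable_geometric_of_lt_one (norm_nonneg _) hw1).mul_right (∫ t, ‖φ t‖))
      rw [← integral_const_mul]
      exact integral_mono (hFi n).norm (hφ.norm.const_mul _) (hbound n)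
    have h := hasSum_integral_of_summable_integral_norm hFi hsum
    have e1 : (fun n => ∫ t, F n t) = fun n : ℕ => a n * Complex.exp (-(Complex.I * n * θ)) := by
      funext n
      rw [hF]
      simp only [integral_const_mul, ha]
      rw [hw, ← Complex.exp_nat_mul, mul_comm]
      congr 2
      ring
    have e2 : ∫ t, ∑' n, F n t = Complex.exp (Complex.I * θ) *
        cauchyTransform φ (Complex.exp (Complex.I * θ)) := by
      rw [cauchyTransform, ← integral_const_mul]
      refine integral_congr_ae (Eventually.of_forall fun t => ?_)
      simp only
      by_cases ht : φ t = 0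
      · simp [hF, ht]
      · have h1 := hmem t ht
        have hr : ‖w * t‖ < 1 := by
          rw [norm_mul, Complex.norm_real, Real.norm_of_nonneg h1.1]
          exact lt_of_le_of_lt (mul_le_of_le_one_right (norm_nonneg _) h1.2) hw1
        have hg := ((hasSum_geometric_of_norm_lt_one hr).mul_right (φ t)).tsum_eq
        simp only [hF, ← mul_assoc, ← mul_pow]
        rw [hg]
        have h0 : 1 - w * t ≠ 0 := by
          intro h
          rw [← sub_eq_zero.mp h, norm_one] at hr
          exact lt_irrefl _ hr
        have h2 : Complex.exp (Complex.I * θ) - t = Complex.exp (Complex.I * θ) * (1 - w * t) := by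
          linear_combination (t : ℂ) * hwe
        have h3 := Complex.exp_ne_zero (Complex.I * θ)
        rw [h2]
        field_simp
    rwa [e1, e2] at h

/-- The exceptional set in `v` is the image under `-log` of a null subset of `(0, ∞)`, and a
differentiable map sends null sets to null sets. -/
theorem ae_comp_exp_neg {p : ℝ → Prop} (h : ∀ᵐ s : ℝ, p s) : ∀ᵐ v : ℝ, p (Real.exp (-v)) := by
  rw [ae_iff] at h ⊢
  refine measure_mono_null (t := (fun s => -Real.log s) '' ({s | ¬p s} ∩ Set.Ioi 0)) ?_ ?_
  · intro v hv
    exact ⟨Real.exp (-v), ⟨hv, Real.exp_pos _⟩, by simp⟩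
  · refine addHaar_image_eq_zero_of_differentiableOn_of_addHaar_eq_zero volume ?_
      (measure_mono_null Set.inter_subset_left h)
    intro s hs
    exact (Real.differentiableAt_log (ne_of_gt hs.2)).neg.differentiableWithinAt

theorem exp_I_mul_add (ε v : ℝ) : Complex.exp (Complex.I * (ε + Complex.I * v)) =
    (⟨Real.exp (-v) * Real.cos ε, Real.exp (-v) * Real.sin ε⟩ : ℂ) := by
  have : Complex.I * (ε + Complex.I * v) = ((-v : ℝ) : ℂ) + ε * Complex.I := by
    push_cast
    linear_combination (v : ℂ) * Complex.I_mul_I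
  apply Complex.ext <;> simp [this, Complex.exp_re, Complex.exp_im]

/-- The two sides of the cut correspond to conjugate points, as the Plemelj difference requires. -/
theorem exp_I_mul_neg_add (ε v : ℝ) : Complex.exp (Complex.I * (-ε + Complex.I * v)) =
    starRingEnd ℂ (Complex.exp (Complex.I * (ε + Complex.I * v))) := by
  have := exp_I_mul_add (-ε) v
  rw [Complex.ofReal_neg] at this
  rw [this, exp_I_mul_add]
  apply Complex.ext <;> simp

theorem add_I_mul_mem_cutDomain {ε v : ℝ} (h0 : ε ≠ 0) (h1 : |ε| < Real.pi) :
    (ε : ℂ) + Complex.I * v ∈ cutDomain := by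
  rintro ⟨k, w, -, h⟩
  have h2 := congrArg Complex.re h
  simp at h2
  rcases eq_or_ne k 0 with rfl | hk
  · simp at h2; exact h0 h2
  · have : (1 : ℝ) ≤ |(k : ℝ)| := by exact_mod_cast Int.one_le_abs hk
    rw [h2, abs_mul, abs_mul, abs_of_pos Real.pi_pos, abs_two] at h1
    nlinarith [Real.pi_pos]

/-- The jump of the extension across the cut. -/
theorem ae_tendsto_trigExtension {φ : ℝ → ℂ} (hφ : MemLp φ 2) (hφ1 : Integrable φ) :
    ∀ᵐ v : ℝ, ∃ fp fm : ℂ,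
      Tendsto (fun ε : ℝ => trigExtension φ (ε + Complex.I * v)) (𝓝[>] 0) (𝓝 fp) ∧
      Tendsto (fun ε : ℝ => trigExtension φ (-ε + Complex.I * v)) (𝓝[>] 0) (𝓝 fm) ∧
      Complex.I * (fp - fm) = Real.exp (-v) * φ (Real.exp (-v)) := by
  obtain ⟨g, hg⟩ := exists_ae_tendsto_cauchyTransform hφ hφ1
  filter_upwards [ae_comp_exp_neg hg] with v hv
  set s := Real.exp (-v) with hs
  have hs0 : 0 < s := Real.exp_pos _
  set ζ : ℝ → ℂ := fun ε => Complex.exp (Complex.I * (ε + Complex.I * v)) with hζ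
  have hζc : Continuous ζ := by fun_prop
  have hζ0 : ζ 0 = s := by
    rw [hζ]
    simp only [exp_I_mul_add]
    rw [← hs]
    apply Complex.ext <;> simp
  have hre : ∀ ε, (ζ ε).re = s * Real.cos ε := fun ε => by rw [hζ]; simp only [exp_I_mul_add]; rfl
  have him : ∀ ε, (ζ ε).im = s * Real.sin ε := fun ε => by rw [hζ]; simp only [exp_I_mul_add]; rfl
  have hlimζ : Tendsto ζ (𝓝[>] 0) (𝓝 (s : ℂ)) := by
    rw [← hζ0]; exact (hζc.tendsto 0).mono_left nhdsWithin_le_nhds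
  have hlim : Tendsto (fun ε => (ζ ε).im) (𝓝[>] 0) (𝓝 0) := by
    simpa [Function.comp_def] using (Complex.continuous_im.tendsto _).comp hlimζ
  have hev : ∀ᶠ ε : ℝ in 𝓝[>] 0, 0 < ε ∧ ε < Real.pi / 2 :=
    Ioo_mem_nhdsGT (by positivity)
  have hpos : ∀ᶠ ε in 𝓝[>] 0, 0 < (ζ ε).im := by
    filter_upwards [hev] with ε hε
    rw [him]
    exact mul_pos hs0 (Real.sin_pos_of_pos_of_lt_pi hε.1 (by linarith [hε.2, Real.pi_pos]))
  -- Horizontal approach to the cut becomes motion along a circle of radius `s`. It stays in the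
  -- cone since `1 ≤ sin ε + cos ε` in the first quadrant.
  have hcone : ∀ᶠ ε in 𝓝[>] 0, |(ζ ε).re - s| ≤ (ζ ε).im := by
    filter_upwards [hev] with ε hε
    have h1 := Real.sin_pos_of_pos_of_lt_pi hε.1 (by linarith [hε.2, Real.pi_pos])
    have h2 := Real.cos_pos_of_mem_Ioo (x := ε) ⟨by linarith [hε.1, Real.pi_pos], hε.2⟩
    have h3 := Real.sin_sq_add_cos_sq ε
    have h4 := Real.sin_le_one ε
    have h5 := Real.cos_le_one ε
    have h6 : 1 ≤ Real.sin ε + Real.cos ε := by nlinarith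
    rw [hre, him, abs_le]
    constructor <;> nlinarith
  obtain ⟨t1, t2⟩ := hv (𝓝[>] 0) ζ hlim hpos hcone
  refine ⟨1 / (2 * (Real.pi : ℂ)) * (s * g s),
    1 / (2 * (Real.pi : ℂ)) * (s * (g s + 2 * Real.pi * Complex.I * φ s)), ?_, ?_, ?_⟩
  · exact (hlimζ.mul t1).const_mul _
  · have hc : Tendsto (fun ε => starRingEnd ℂ (ζ ε)) (𝓝[>] 0) (𝓝 (s : ℂ)) := by
      simpa [Function.comp_def] using (Complex.continuous_conj.tendsto _).comp hlimζ
    refine ((hc.mul t2).const_mul _).congr fun ε => ?_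
    rw [trigExtension, exp_I_mul_neg_add]
  · have hpi : (Real.pi : ℂ) ≠ 0 := by exact_mod_cast Real.pi_ne_zero
    field_simp
    linear_combination (-(s : ℂ) * φ s * 2 * Real.pi) * Complex.I_mul_I

theorem IsHolomorphicExtension.ae_jump {a : ℕ → ℂ} {φ : ℝ → ℂ} {f : ℂ → ℂ} (hφ : MemLp φ 2)
    (hφ1 : Integrable φ) (hsupp : ∀ x ∉ Set.Ioo (0 : ℝ) 1, φ x = 0)
    (ha : ∀ n : ℕ, ∫ x : ℝ, (x : ℂ) ^ n * φ x = a n) (hf : IsHolomorphicExtension a f) :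
    IsJumpFunction f (fun v => Real.exp (-v) * φ (Real.exp (-v))) ∧
      ∀ F : ℝ → ℂ, IsJumpFunction f F → ∀ᵐ v ∂(volume.restrict (Set.Ioi (0 : ℝ))),
        F v = Real.exp (-v) * φ (Real.exp (-v)) := by
  have hEq := (isHolomorphicExtension_trigExtension hφ1 hsupp ha).eqOn hf
  have hev : ∀ᶠ ε : ℝ in 𝓝[>] 0, 0 < ε ∧ ε < Real.pi :=
    Ioo_mem_nhdsGT Real.pi_pos
  have hJ : IsJumpFunction f (fun v => Real.exp (-v) * φ (Real.exp (-v))) := by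
    refine ae_restrict_of_ae ?_
    filter_upwards [ae_tendsto_trigExtension hφ hφ1] with v hv
    obtain ⟨fp, fm, h1, h2, h3⟩ := hv
    refine ⟨fp, fm, h1.congr' ?_, h2.congr' ?_, h3.symm⟩
    · filter_upwards [hev] with ε hε
      exact hEq (add_I_mul_mem_cutDomain hε.1.ne' (by rw [abs_of_pos hε.1]; exact hε.2))
    · filter_upwards [hev] with ε hε
      have := add_I_mul_mem_cutDomain (ε := -ε) (v := v) (by simpa using hε.1.ne')
        (by rw [abs_neg, abs_of_pos hε.1]; exact hε.2)
      rw [Complex.ofReal_neg] at this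
      exact hEq this
  refine ⟨hJ, fun F hF => ?_⟩
  filter_upwards [hJ, hF] with v h1 h2
  obtain ⟨p, m, hp, hm, h⟩ := h1
  obtain ⟨p', m', hp', hm', h'⟩ := h2
  rw [h', h, tendsto_nhds_unique hp hp', tendsto_nhds_unique hm hm']

/-! ### Orthonormality of the Laguerre functions. -/

theorem eval_laguerre (m : ℕ) (y : ℝ) : (laguerre m).eval y =
    ∑ k ∈ Finset.range (m + 1), (-1) ^ k * (m.choose k : ℝ) / (k.factorial : ℝ) * y ^ k := by
  simp [laguerre, eval_finsetSum]

theorem integrableOn_pow_mul_exp_neg (n : ℕ) :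
    IntegrableOn (fun x : ℝ => x ^ n * Real.exp (-x)) (Set.Ioi 0) ∧
      ∫ x in Set.Ioi (0 : ℝ), x ^ n * Real.exp (-x) = n.factorial := by
  have h1 := Real.GammaIntegral_convergent (s := (n : ℝ) + 1) (by positivity)
  have h2 := Real.Gamma_eq_integral (s := (n : ℝ) + 1) (by positivity)
  rw [Real.Gamma_nat_eq_factorial] at h2
  have e : ∀ x ∈ Set.Ioi (0 : ℝ), Real.exp (-x) * x ^ ((n : ℝ) + 1 - 1) = x ^ n * Real.exp (-x) := by
    intro x _
    rw [add_sub_cancel_right, Real.rpow_natCast, mul_comm]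
  exact ⟨h1.congr_fun e measurableSet_Ioi, by rw [h2, setIntegral_congr_fun measurableSet_Ioi e]⟩

/-- Up to sign the sum is the `n`-th difference of `x ↦ (x choose k)` at `k`, namely `(k choose
k-n)`, or zero when `n > k`. -/
theorem sum_neg_one_pow_choose_mul_choose (n k : ℕ) :
    ∑ j ∈ Finset.range (n + 1), (-1 : ℤ) ^ j * n.choose j * ((k + j).choose k) =
      (-1) ^ n * k.choose n := by
  have h := fwdDiff_iter_eq_sum_shift 1 (fun x => (x.choose k : ℤ)) n k
  have h2 : ((fwdDiff 1)^[n] (fun x => (x.choose k : ℤ))) k = k.choose n := by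
    rcases le_or_gt n k with hnk | hnk
    · obtain ⟨j, rfl⟩ := Nat.exists_eq_add_of_le hnk
      rw [fwdDiff_iter_choose, Nat.choose_symm_add]
    · obtain ⟨j, rfl⟩ := Nat.exists_eq_add_of_lt hnk
      have h0 := fwdDiff_iter_choose 0 k
      simp only [add_zero, Nat.choose_zero_right, Nat.cast_one] at h0
      have : k + j + 1 = (j + 1) + k := by ring
      rw [this, Function.iterate_add_apply, h0, Nat.choose_eq_zero_of_lt (by omega),
        Function.iterate_succ_apply, fwdDiff_const]
      simp [fwdDiff_iter_eq_sum_shift]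
  rw [h2] at h
  rw [h, Finset.mul_sum]
  refine Finset.sum_congr rfl fun j hj => ?_
  have hj' : j ≤ n := Nat.lt_succ_iff.mp (Finset.mem_range.mp hj)
  obtain ⟨i, rfl⟩ := Nat.exists_eq_add_of_le hj'
  have h3 : (-1 : ℤ) ^ i * (-1) ^ i = 1 := by rw [← mul_pow]; simp
  rw [Nat.add_sub_cancel_left, smul_eq_mul, smul_eq_mul, mul_one, pow_add]
  linear_combination (-(-1) ^ j * ((j + i).choose j : ℤ) * ((k + j).choose k : ℤ)) * h3

/-- Termwise integration gives `(k+j)!/j! = k! (k+j choose k)`, and the alternating sum applies. The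
value vanishes for `k < n`, so only the top coefficient counts in the orthogonality relations. -/
theorem integral_pow_mul_laguerre (k n : ℕ) :
    IntegrableOn (fun y : ℝ => y ^ k * (laguerre n).eval y * Real.exp (-y)) (Set.Ioi 0) ∧
    ∫ y in Set.Ioi (0 : ℝ), y ^ k * (laguerre n).eval y * Real.exp (-y) =
      k.factorial * ((-1) ^ n * k.choose n) := by
  have e : ∀ y : ℝ, y ^ k * (laguerre n).eval y * Real.exp (-y) =
      ∑ j ∈ Finset.range (n + 1), ((-1) ^ j * (n.choose j : ℝ) / (j.factorial : ℝ)) *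
        (y ^ (k + j) * Real.exp (-y)) := by
    intro y
    rw [eval_laguerre, Finset.mul_sum, Finset.sum_mul]
    refine Finset.sum_congr rfl fun j _ => ?_
    rw [pow_add]; ring
  simp only [e]
  have hi : ∀ j ∈ Finset.range (n + 1), IntegrableOn (fun y : ℝ =>
      ((-1) ^ j * (n.choose j : ℝ) / (j.factorial : ℝ)) * (y ^ (k + j) * Real.exp (-y)))
      (Set.Ioi 0) := fun j _ => (integrableOn_pow_mul_exp_neg (k + j)).1.const_mul _
  refine ⟨integrable_finsetSum _ hi, ?_⟩
  rw [integral_finsetSum _ hi]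
  have h := sum_neg_one_pow_choose_mul_choose n k
  have h' : ∑ j ∈ Finset.range (n + 1), (-1 : ℝ) ^ j * n.choose j * ((k + j).choose k) =
      (-1) ^ n * k.choose n := by exact_mod_cast h
  rw [← h', Finset.mul_sum]
  refine Finset.sum_congr rfl fun j _ => ?_
  rw [integral_const_mul, (integrableOn_pow_mul_exp_neg (k + j)).2,
    ← Nat.add_choose_mul_factorial_mul_factorial k j]
  have : (j.factorial : ℝ) ≠ 0 := by positivity
  rw [Nat.choose_symm_add]
  push_cast
  field_simp

theorem integral_laguerre_mul_laguerre_of_le {m n : ℕ} (h : m ≤ n) :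
    ∫ y in Set.Ioi (0 : ℝ), (laguerre m).eval y * (laguerre n).eval y * Real.exp (-y) =
      if m = n then 1 else 0 := by
  have e : ∀ y : ℝ, (laguerre m).eval y * (laguerre n).eval y * Real.exp (-y) =
      ∑ k ∈ Finset.range (m + 1), ((-1) ^ k * (m.choose k : ℝ) / (k.factorial : ℝ)) *
        (y ^ k * (laguerre n).eval y * Real.exp (-y)) := by
    intro y
    rw [eval_laguerre m, Finset.sum_mul, Finset.sum_mul]
    exact Finset.sum_congr rfl fun j _ => by ring
  simp only [e]
  rw [integral_finsetSum _ fun k _ => (integral_pow_mul_laguerre k n).1.const_mul _]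
  simp only [integral_const_mul, (integral_pow_mul_laguerre _ n).2]
  rw [Finset.sum_range_succ, Finset.sum_eq_zero, zero_add]
  · split_ifs with hmn
    · subst hmn
      have : (m.factorial : ℝ) ≠ 0 := by positivity
      have h2 : ((-1 : ℝ) ^ m) * (-1) ^ m = 1 := by rw [← mul_pow]; simp
      rw [Nat.choose_self]
      field_simp
      push_cast
      linear_combination h2
    · rw [Nat.choose_eq_zero_of_lt (lt_of_le_of_ne h hmn)]
      simp
  · intro k hk
    rw [Nat.choose_eq_zero_of_lt (lt_of_lt_of_le (Finset.mem_range.mp hk) h)]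
    simp

theorem integral_laguerre_mul_laguerre (m n : ℕ) :
    ∫ y in Set.Ioi (0 : ℝ), (laguerre m).eval y * (laguerre n).eval y * Real.exp (-y) =
      if m = n then 1 else 0 := by
  rcases le_total m n with h | h
  · exact integral_laguerre_mul_laguerre_of_le h
  · have := integral_laguerre_mul_laguerre_of_le h
    simp only [mul_comm ((laguerre n).eval _)] at this
    rw [this]
    simp [eq_comm]

/-- The Laguerre functions `√2 L_m(2x) e^{-x}`, orthonormal in `L²(0, ∞)`. -/
noncomputable def laguerreL2 (m : ℕ) (x : ℝ) : ℝ :=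
  √2 * (laguerre m).eval (2 * x) * Real.exp (-x)

theorem integral_laguerreL2_mul (m n : ℕ) :
    ∫ x in Set.Ioi (0 : ℝ), laguerreL2 m x * laguerreL2 n x = if m = n then 1 else 0 := by
  have h := integral_comp_mul_left_Ioi
    (fun y => (laguerre m).eval y * (laguerre n).eval y * Real.exp (-y)) 0 (zero_lt_two (α := ℝ))
  rw [mul_zero, integral_laguerre_mul_laguerre] at h
  have e : ∀ x : ℝ, laguerreL2 m x * laguerreL2 n x = 2 * ((laguerre m).eval (2 * x) *
      (laguerre n).eval (2 * x) * Real.exp (-(2 * x))) := by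
    intro x
    rw [laguerreL2, laguerreL2, show -(2 * x) = -x + -x by ring, Real.exp_add]
    linear_combination ((laguerre m).eval (2 * x) * (laguerre n).eval (2 * x) * Real.exp (-x) *
      Real.exp (-x)) * Real.mul_self_sqrt (zero_le_two (α := ℝ))
  simp only [e, integral_const_mul]
  rw [h]
  simp

theorem memLp_laguerreL2 (m : ℕ) :
    MemLp (fun x => (laguerreL2 m x : ℂ)) 2 (volume.restrict (Set.Ioi 0)) := by
  suffices h : MemLp (laguerreL2 m) 2 (volume.restrict (Set.Ioi 0)) from h.ofReal
  have hmono : ∀ k : ℕ, MemLp (fun x : ℝ => x ^ k * Real.exp (-x)) 2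
      (volume.restrict (Set.Ioi 0)) := by
    intro k
    rw [memLp_two_iff_integrable_sq (by fun_prop)]
    have h := (integrableOn_pow_mul_exp_neg (2 * k)).1
    have h2 := (integrableOn_Ioi_comp_mul_left_iff _ 0 (zero_lt_two (α := ℝ))).mpr
      (by rwa [mul_zero])
    refine (h2.const_mul (((2 : ℝ) ^ (2 * k))⁻¹)).congr (Eventually.of_forall fun x => ?_)
    simp only
    rw [mul_pow, ← mul_assoc, ← mul_assoc, inv_mul_cancel₀ (by positivity), one_mul, mul_pow,
      ← pow_mul, mul_comm k 2, ← Real.exp_nat_mul]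
    congr 2
    push_cast
    ring
  have e : laguerreL2 m = fun x => ∑ k ∈ Finset.range (m + 1),
      (√2 * ((-1) ^ k * (m.choose k : ℝ) / (k.factorial : ℝ)) * 2 ^ k) *
        (x ^ k * Real.exp (-x)) := by
    funext x
    rw [laguerreL2, eval_laguerre, Finset.mul_sum, Finset.sum_mul]
    refine Finset.sum_congr rfl fun k _ => ?_
    rw [mul_pow]; ring
  rw [e]
  exact memLp_finsetSum _ fun k _ => (hmono k).const_mul _

/-! ### Completeness of the Laguerre functions. -/

/-- The generating function of the Laguerre polynomials. -/
theorem hasSum_laguerre {z : ℝ} (hz0 : 0 ≤ z) (hz1 : z < 1) (y : ℝ) :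
    HasSum (fun m => z ^ m * (laguerre m).eval y) (1 / (1 - z) * Real.exp (-(y * z / (1 - z)))) := by
  have h1z : 0 < 1 - z := by linarith
  have hzn : ‖z‖ < 1 := by rwa [Real.norm_of_nonneg hz0]
  set f : ℝ → ℕ × ℕ → ℝ := fun y p => ((p.2 + p.1).choose p.1 * z ^ p.2) *
    ((z * y) ^ p.1 / p.1.factorial) with hf
  have hcol : ∀ y k, HasSum (fun j => f y (k, j)) (1 / (1 - z) ^ (k + 1) *
      ((z * y) ^ k / k.factorial)) := fun y k =>
    (hasSum_choose_mul_geometric_of_norm_lt_one k hzn).mul_right _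
  have hexp : ∀ y, HasSum (fun k : ℕ => 1 / (1 - z) ^ (k + 1) * ((z * y) ^ k / k.factorial))
      (1 / (1 - z) * Real.exp (y * z / (1 - z))) := by
    intro y
    have h := (NormedSpace.expSeries_div_hasSum_exp (y * z / (1 - z))).mul_left (1 / (1 - z))
    rw [← Real.exp_eq_exp_ℝ] at h
    refine h.congr_fun fun k => ?_
    rw [div_pow, mul_comm z y, pow_succ]
    field_simp
  -- The absolute values of the terms at `-y` are the terms at `|y|`, whose iterated sum is the
  -- exponential series already evaluated.
  have hsum : Summable (f (-y)) := by
    rw [← summable_abs_iff]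
    have habs : ∀ p, |f (-y) p| = f |y| p := fun p => by
      rw [hf]
      simp only [abs_mul, abs_div, abs_pow, abs_neg, abs_of_nonneg hz0, Nat.abs_cast]
    simp only [habs]
    rw [summable_prod_of_nonneg (fun p => by rw [← habs]; exact abs_nonneg _)]
    refine ⟨fun k => (hcol |y| k).summable, ?_⟩
    simp only [(hcol |y| _).tsum_eq]
    exact (hexp |y|).summable
  have htot : HasSum (f (-y)) (1 / (1 - z) * Real.exp (-(y * z / (1 - z)))) := by
    have h := hsum.hasSum.prod_fiberwise (hcol (-y))
    have h2 := hexp (-y)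
    rw [neg_mul, neg_div] at h2
    rw [← h.unique h2]
    exact hsum.hasSum
  -- The double series is regrouped by `m = k + j`; each antidiagonal sums to `z^m L_m(y)`.
  rw [← Finset.HasAntidiagonal.sigmaAntidiagonalEquivProd.hasSum_iff] at htot
  have h3 := htot.sigma fun m => hasSum_fintype _
  refine h3.congr_fun fun m => ?_
  rw [eval_laguerre, Finset.mul_sum, Finset.univ_eq_attach]
  simp only [Function.comp, Finset.HasAntidiagonal.sigmaAntidiagonalEquivProd_apply]
  rw [Finset.sum_attach (Finset.HasAntidiagonal.antidiagonal m) (f (-y)), Finset.Nat.sum_antidiagonal_eq_sum_range_succ_mk]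
  refine Finset.sum_congr rfl fun k hk => ?_
  obtain ⟨j, rfl⟩ := Nat.exists_eq_add_of_le (Nat.lt_succ_iff.mp (Finset.mem_range.mp hk))
  simp only [hf, Nat.add_sub_cancel_left, Nat.add_comm j k, mul_pow, pow_add]
  ring

/-- The generating function writes each exponential `e^{-(n+1)x}` as a series of Laguerre functions.
Each term of the integrated series is at most `z^m` times the norm of `h`, so orthogonality passes
to the sum. -/
theorem integral_mul_exp_of_orthogonal_laguerreL2 {h : ℝ → ℂ}
    (hh : MemLp h 2 (volume.restrict (Set.Ioi 0)))
    (horth : ∀ m, ∫ x in Set.Ioi (0 : ℝ), (laguerreL2 m x : ℂ) * h x = 0) (n : ℕ) :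
    ∫ x in Set.Ioi (0 : ℝ), (Real.exp (-x) ^ n : ℂ) * (Real.exp (-x) * h x) = 0 := by
  -- Chosen so that `2z/(1 - z) = n`.
  set z : ℝ := n / (n + 2) with hz
  have hn : (0 : ℝ) < (n : ℝ) + 2 := by positivity
  have hz0 : 0 ≤ z := by positivity
  have hz1 : z < 1 := by rw [hz, div_lt_one hn]; linarith
  have h1z : 1 - z = 2 / (n + 2) := by rw [hz]; field_simp; ring
  have hpt : ∀ x : ℝ, HasSum (fun m => (z ^ m : ℂ) * ((laguerreL2 m x : ℂ) * h x))
      (((√2 / (1 - z) : ℝ) : ℂ) * ((Real.exp (-x) ^ n : ℂ) * (Real.exp (-x) * h x))) := by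
    intro x
    have h1 := ((hasSum_laguerre hz0 hz1 (2 * x)).mul_left (√2)).mul_right (Real.exp (-x))
    have h2 := (Complex.hasSum_ofReal.mpr h1).mul_right (h x)
    have e : Real.exp (-(2 * x * z / (1 - z))) = Real.exp (-x) ^ n := by
      rw [← Real.exp_nat_mul, h1z, hz]
      congr 1
      field_simp
    rw [e] at h2
    convert! h2 using 1
    · funext m
      rw [laguerreL2]
      push_cast
      ring
    · push_cast
      ring
  set A : ℝ := ∫ x in Set.Ioi (0 : ℝ), ‖h x‖ ^ 2 with hA
  have hint : ∀ m, IntegrableOn (fun x => (z ^ m : ℂ) * ((laguerreL2 m x : ℂ) * h x))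
      (Set.Ioi 0) := fun m => ((memLp_laguerreL2 m).integrable_mul hh).const_mul _
  have hsum : Summable fun m => ∫ x in Set.Ioi (0 : ℝ),
      ‖(z ^ m : ℂ) * ((laguerreL2 m x : ℂ) * h x)‖ := by
    refine Summable.of_nonneg_of_le (fun m => integral_nonneg fun x => norm_nonneg _) (fun m => ?_)
      ((summable_geometric_of_lt_one hz0 hz1).mul_right (√A))
    simp only [norm_mul, norm_pow, Complex.norm_real, Real.norm_of_nonneg hz0, integral_const_mul]
    gcongr
    refine Real.le_sqrt_of_sq_le ?_
    have h1 := norm_integral_mul_sq_le (f := fun x => ((‖(laguerreL2 m x : ℂ)‖ : ℝ) : ℂ))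
      (g := fun x => ((‖h x‖ : ℝ) : ℂ)) (memLp_laguerreL2 m).norm.ofReal hh.norm.ofReal
    simp only [Complex.norm_real, norm_norm] at h1
    have h2 : ∫ x in Set.Ioi (0 : ℝ), ‖laguerreL2 m x‖ ^ 2 = 1 := by
      have := integral_laguerreL2_mul m m
      rw [if_pos rfl] at this
      rw [← this]
      exact integral_congr_ae (Eventually.of_forall fun x => by simp [sq])
    rw [h2, one_mul] at h1
    refine le_trans (le_of_eq ?_) h1
    simp only [← Complex.ofReal_mul, integral_complex_ofReal, Complex.norm_real]
    rw [Real.norm_of_nonneg (integral_nonneg fun x => by positivity)]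
  have hfin := hasSum_integral_of_summable_integral_norm hint hsum
  simp only [(hpt _).tsum_eq, integral_const_mul, horth, mul_zero] at hfin
  have h0 := hfin.unique hasSum_zero
  refine (mul_eq_zero.mp h0).resolve_left ?_
  rw [h1z]
  have : √2 / (2 / ((n : ℝ) + 2)) ≠ 0 := by positivity
  exact_mod_cast this

/-- A function on the half-line is determined by its integrals against `e^{-nx}`. -/
theorem ae_eq_zero_of_integral_exp_pow_mul {H : ℝ → ℂ} (hH : IntegrableOn H (Set.Ioi 0))
    (h : ∀ n : ℕ, ∫ x in Set.Ioi (0 : ℝ), (Real.exp (-x) ^ n : ℂ) * H x = 0) :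
    ∀ᵐ x : ℝ, x ∈ Set.Ioi (0 : ℝ) → H x = 0 := by
  refine isOpen_Ioi.ae_eq_zero_of_integral_contDiff_smul_eq_zero hH.locallyIntegrableOn ?_
  intro g hg hgc hgs
  have hg0 : ∀ x, x ∉ Set.Ioi (0 : ℝ) → g x = 0 := fun x hx =>
    image_eq_zero_of_notMem_tsupport fun h => hx (hgs h)
  have e1 : ∫ x, g x • H x = ∫ x in Set.Ioi (0 : ℝ), (g x : ℂ) * H x := by
    rw [setIntegral_eq_integral_of_forall_compl_eq_zero]
    · simp
    · intro x hx; simp [hg0 x hx]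
  rw [e1]
  -- In the variable `y = e^{-x}` the test function becomes continuous on `[0, 1]`, and the
  -- hypothesis says that `H` annihilates polynomials in `y`, so Weierstrass approximation applies.
  set f : ℝ → ℝ := fun y => g (-Real.log y) with hf
  -- `Real.log 0 = 0`, so `f 0 = g 0`, which vanishes because `g` is supported in `(0, ∞)`. This
  -- agrees with the limit at `0`, as `g` vanishes near infinity.
  have hf0 : f 0 = 0 := by simp [hf, hg0]
  have hfc : ContinuousOn f (Set.Icc 0 1) := by
    intro y hy
    rcases hy.1.eq_or_lt with h0 | h0
    · subst h0
      refine ContinuousAt.continuousWithinAt ?_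
      have hlog : ∀ᶠ y : ℝ in 𝓝[≠] 0, f y = 0 := by
        have h1 : Tendsto (fun y => -Real.log y) (𝓝[≠] 0) atTop :=
          tendsto_neg_atBot_atTop.comp Real.tendsto_log_nhdsNE_zero
        have h2 : ∀ᶠ x in atTop, g x = 0 := by
          have h3 := hgc.isCompact.isBounded.bddAbove
          obtain ⟨b, hb⟩ := h3
          filter_upwards [eventually_gt_atTop b] with x hx
          exact image_eq_zero_of_notMem_tsupport fun h => absurd (hb h) (not_le.mpr hx)
        exact h1.eventually h2
      rw [← continuousWithinAt_compl_self, ContinuousWithinAt, hf0]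
      exact tendsto_const_nhds.congr' (hlog.mono fun y hy => hy.symm)
    · exact (hg.continuous.continuousAt.comp
        (Real.continuousAt_log h0.ne').neg).continuousWithinAt
  have hHn : 0 ≤ ∫ x in Set.Ioi (0 : ℝ), ‖H x‖ := integral_nonneg fun x => norm_nonneg _
  have hHg : IntegrableOn (fun x => (g x : ℂ) * H x) (Set.Ioi 0) := by
    obtain ⟨C, hC⟩ := hg.continuous.bounded_above_of_compact_support hgc
    exact hH.bdd_mul (c := C) (Complex.continuous_ofReal.comp hg.continuous).aestronglyMeasurable
      (Eventually.of_forall fun x => by simpa using hC x)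
  have hexpb : ∀ x ∈ Set.Ioi (0 : ℝ), Real.exp (-x) ∈ Set.Icc (0 : ℝ) 1 := fun x hx =>
    ⟨(Real.exp_pos _).le, Real.exp_le_one_iff.mpr (by simpa using le_of_lt hx)⟩
  have hpi : ∀ p : ℝ[X], IntegrableOn (fun x => ((p.eval (Real.exp (-x)) : ℝ) : ℂ) * H x) (Set.Ioi 0) ∧
      ∫ x in Set.Ioi (0 : ℝ), ((p.eval (Real.exp (-x)) : ℝ) : ℂ) * H x = 0 := by
    intro p
    have hmono : ∀ n : ℕ, IntegrableOn (fun x => (Real.exp (-x) ^ n : ℂ) * H x) (Set.Ioi 0) := by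
      intro n
      refine Integrable.bdd_mul (c := 1) hH ?_ ?_
      · exact (by fun_prop : Continuous fun x : ℝ =>
          ((Real.exp (-x) : ℝ) : ℂ) ^ n).aestronglyMeasurable
      · filter_upwards [ae_restrict_mem measurableSet_Ioi] with x hx
        rw [norm_pow, Complex.norm_real, Real.norm_of_nonneg (hexpb x hx).1]
        exact pow_le_one₀ (hexpb x hx).1 (hexpb x hx).2
    have e : ∀ x, ((p.eval (Real.exp (-x)) : ℝ) : ℂ) * H x = ∑ n ∈ Finset.range (p.natDegree + 1),
        (p.coeff n : ℂ) * ((Real.exp (-x) ^ n : ℂ) * H x) := by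
      intro x
      rw [eval_eq_sum_range, Complex.ofReal_sum, Finset.sum_mul]
      refine Finset.sum_congr rfl fun n _ => ?_
      push_cast
      ring
    simp only [e]
    have hi := fun n (_ : n ∈ Finset.range (p.natDegree + 1)) =>
      (hmono n).const_mul (p.coeff n : ℂ)
    refine ⟨integrable_finsetSum _ hi, ?_⟩
    rw [integral_finsetSum _ hi]
    simp only [integral_const_mul, h, mul_zero, Finset.sum_const_zero]
  rw [← norm_le_zero_iff]
  refine le_of_forall_pos_le_add fun ε hε => ?_
  set K := ∫ x in Set.Ioi (0 : ℝ), ‖H x‖ with hK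
  obtain ⟨p, hp⟩ := exists_polynomial_near_of_continuousOn 0 1 f hfc (ε / (K + 1)) (by positivity)
  have e2 : ∫ x in Set.Ioi (0 : ℝ), (g x : ℂ) * H x = ∫ x in Set.Ioi (0 : ℝ),
      ((g x : ℂ) * H x - ((p.eval (Real.exp (-x)) : ℝ) : ℂ) * H x) := by
    rw [integral_sub hHg (hpi p).1, (hpi p).2, sub_zero]
  rw [e2, zero_add]
  calc _ ≤ ∫ x in Set.Ioi (0 : ℝ), ε / (K + 1) * ‖H x‖ := by
        refine norm_integral_le_of_norm_le (hH.norm.const_mul _) ?_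
        filter_upwards [ae_restrict_mem measurableSet_Ioi] with x hx
        rw [← sub_mul, norm_mul, ← Complex.ofReal_sub, Complex.norm_real, norm_sub_rev]
        gcongr
        have := (hp _ (hexpb x hx)).le
        simpa [hf] using this
    _ = ε / (K + 1) * K := by rw [integral_const_mul]
    _ ≤ ε := by
        rw [div_mul_eq_mul_div, div_le_iff₀ (by positivity)]
        nlinarith

theorem MeasureTheory.MemLp.toLp_finsetSum {α ι : Type*} [MeasurableSpace α] {μ : Measure α}
    {u : ι → α → ℂ} (hu : ∀ i, MemLp (u i) 2 μ) (s : Finset ι) :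
    (memLp_finsetSum s fun i _ => hu i).toLp (fun x => ∑ i ∈ s, u i x) =
      ∑ i ∈ s, (hu i).toLp (u i) := by
  classical
  induction s using Finset.induction_on with
  | empty =>
    simp only [Finset.sum_empty]
    exact MemLp.toLp_zero _
  | insert i s hi ih =>
    rw [Finset.sum_insert hi, ← ih, ← MemLp.toLp_add]
    congr 1
    funext x
    simp [Finset.sum_insert hi]

/-- The function `e^{-x} h` is integrable, being a product of two `L²` functions, and is annihilated
by all `e^{-nx}`. The weight never vanishes, so `h` does. -/
theorem ae_eq_zero_of_orthogonal_laguerreL2 {h : ℝ → ℂ}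
    (hh : MemLp h 2 (volume.restrict (Set.Ioi 0)))
    (horth : ∀ m, ∫ x in Set.Ioi (0 : ℝ), (laguerreL2 m x : ℂ) * h x = 0) :
    h =ᵐ[volume.restrict (Set.Ioi 0)] 0 := by
  have hexp : MemLp (fun x : ℝ => ((Real.exp (-x) : ℝ) : ℂ)) 2 (volume.restrict (Set.Ioi 0)) := by
    refine ((memLp_laguerreL2 0).const_mul (((√2)⁻¹ : ℝ) : ℂ)).ae_eq
      (Eventually.of_forall fun x => ?_)
    simp only [laguerreL2, ← Complex.ofReal_mul]
    have h2 : (√2 : ℝ) ≠ 0 := by positivity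
    simp [eval_laguerre, h2]
  have := ae_eq_zero_of_integral_exp_pow_mul (hexp.integrable_mul hh)
    (fun n => integral_mul_exp_of_orthogonal_laguerreL2 hh horth n)
  rw [Filter.EventuallyEq, ae_restrict_iff' measurableSet_Ioi]
  filter_upwards [this] with x hx hx0
  have := hx hx0
  simp only [Pi.mul_apply] at this
  exact (mul_eq_zero.mp this).resolve_left (by exact_mod_cast (Real.exp_pos _).ne')

/-- Expansion of a square integrable function in Laguerre functions. -/
theorem tendsto_eLpNorm_sub_sum_laguerreL2 {φ : ℝ → ℂ}
    (hφ : MemLp φ 2 (volume.restrict (Set.Ioi 0))) :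
    Tendsto (fun N : ℕ => eLpNorm (fun x => φ x - ∑ m ∈ Finset.range N,
      (∫ x in Set.Ioi (0 : ℝ), (laguerreL2 m x : ℂ) * φ x) * laguerreL2 m x) 2
      (volume.restrict (Set.Ioi 0))) atTop (𝓝 0) := by
  set v : ℕ → Lp ℂ 2 (volume.restrict (Set.Ioi (0 : ℝ))) := fun m => (memLp_laguerreL2 m).toLp _
    with hv
  have hinner : ∀ (m : ℕ) {u : ℝ → ℂ} (hu : MemLp u 2 (volume.restrict (Set.Ioi 0))),
      inner ℂ (v m) (hu.toLp u) = ∫ x in Set.Ioi (0 : ℝ), (laguerreL2 m x : ℂ) * u x := by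
    intro m u hu
    rw [hv]
    simp only [inner_toLp_toLp, Complex.conj_ofReal]
  have hon : Orthonormal ℂ v := by
    rw [orthonormal_iff_ite]
    intro m n
    rw [hv, ← hv, hinner m (memLp_laguerreL2 n)]
    simp only [← Complex.ofReal_mul, integral_complex_ofReal, integral_laguerreL2_mul]
    split_ifs <;> simp
  have hbot : (Submodule.span ℂ (Set.range v))ᗮ = ⊥ := by
    rw [Submodule.eq_bot_iff]
    intro w hw
    have hw' : ∀ m, ∫ x in Set.Ioi (0 : ℝ), (laguerreL2 m x : ℂ) * w x = 0 := by
      intro m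
      rw [← hinner m (Lp.memLp w), Lp.toLp_coeFn]
      exact (Submodule.mem_orthogonal _ _).mp hw _ (Submodule.subset_span ⟨m, rfl⟩)
    rw [Lp.eq_zero_iff_ae_eq_zero]
    exact ae_eq_zero_of_orthogonal_laguerreL2 (Lp.memLp w) hw'
  set b := HilbertBasis.mkOfOrthogonalEqBot hon hbot with hb
  have hsum := (b.hasSum_repr (hφ.toLp φ)).tendsto_sum_nat
  have h1 := (tendsto_const_nhds (x := hφ.toLp φ)).sub hsum
  rw [sub_self] at h1
  have h2 := h1.enorm
  simp only [enorm_zero] at h2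
  refine h2.congr fun N => ?_
  rw [Lp.enorm_def]
  refine eLpNorm_congr_ae ?_
  have hcoe : ∀ m, b m = v m := fun m => by rw [hb, HilbertBasis.coe_mkOfOrthogonalEqBot]
  have hS : ∑ m ∈ Finset.range N, b.repr (hφ.toLp φ) m • b m =
      (memLp_finsetSum (Finset.range N) fun m _ => (memLp_laguerreL2 m).const_mul
        (∫ x in Set.Ioi (0 : ℝ), (laguerreL2 m x : ℂ) * φ x)).toLp _ := by
    rw [MemLp.toLp_finsetSum fun m => (memLp_laguerreL2 m).const_mul
      (∫ x in Set.Ioi (0 : ℝ), (laguerreL2 m x : ℂ) * φ x)]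
    refine Finset.sum_congr rfl fun m _ => ?_
    rw [HilbertBasis.repr_apply_apply, hcoe, hinner m hφ]
    rfl
  rw [hS, ← MemLp.toLp_sub]
  exact MemLp.coeFn_toLp _

/-! ### Pollaczek values, Delannoy numbers and Laguerre coefficients. -/

theorem succ_mul_choose_succ_cast (n k : ℕ) :
    ((k : ℂ) + 1) * (n.choose (k + 1) : ℂ) = ((n : ℂ) - k) * (n.choose k : ℂ) := by
  rcases le_or_gt k n with h | h
  · have h1 := Nat.choose_succ_right_eq n k
    have h2 : (n.choose (k + 1) : ℂ) * ((k : ℂ) + 1) = (n.choose k : ℂ) * ((n - k : ℕ) : ℂ) := by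
      exact_mod_cast h1
    rw [Nat.cast_sub h] at h2
    linear_combination h2
  · rw [Nat.choose_eq_zero_of_lt h, Nat.choose_eq_zero_of_lt (by omega)]
    simp

theorem succ_mul_choose_cast (n k : ℕ) :
    ((n : ℂ) + 1) * (n.choose k : ℂ) = ((n : ℂ) + 1 - k) * ((n + 1).choose k : ℂ) := by
  rcases le_or_gt k (n + 1) with h | h
  · have h1 := Nat.choose_mul_succ_eq n k
    have h2 : (n.choose k : ℂ) * ((n : ℂ) + 1) = ((n + 1).choose k : ℂ) * ((n + 1 - k : ℕ) : ℂ) := by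
      exact_mod_cast h1
    rw [Nat.cast_sub h] at h2
    push_cast at h2
    linear_combination h2
  · rw [Nat.choose_eq_zero_of_lt h, Nat.choose_eq_zero_of_lt (by omega)]
    simp

/-- The Delannoy numbers. -/
def delannoy (m n : ℕ) : ℕ := ∑ k ∈ Finset.range (m + 1), m.choose k * (2 ^ k * n.choose k)

theorem delannoy_eq_sum_of_lt {m N : ℕ} (h : m < N) (n : ℕ) :
    delannoy m n = ∑ k ∈ Finset.range N, m.choose k * (2 ^ k * n.choose k) := by
  refine Finset.sum_subset (Finset.range_subset_range.mpr h) fun k _ hk => ?_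
  rw [Finset.mem_range, not_lt] at hk
  rw [Nat.choose_eq_zero_of_lt hk, zero_mul]

/-- With `T k = 2^k (n choose k)`, multiplication by `2n + 1` acts as `T k ↦ (k+1) T(k+1) + (2k+1) T
k`. Comparing the coefficients of `T (k+1)` leaves an identity between binomials in `m`. -/
theorem delannoy_recurrence (m n : ℕ) : ((m : ℂ) + 2) * (delannoy (m + 2) n : ℂ) =
    (2 * (n : ℂ) + 1) * (delannoy (m + 1) n : ℂ) + ((m : ℂ) + 1) * (delannoy m n : ℂ) := by
  set T : ℕ → ℂ := fun k => 2 ^ k * (n.choose k : ℂ) with hT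
  have e2 : (delannoy (m + 2) n : ℂ) =
      ∑ k ∈ Finset.range (m + 2), ((m + 2).choose (k + 1) : ℂ) * T (k + 1) + T 0 := by
    rw [delannoy_eq_sum_of_lt (N := m + 3) (by omega), Finset.sum_range_succ']
    push_cast
    simp [hT]
  have e1 : (delannoy (m + 1) n : ℂ) =
      ∑ k ∈ Finset.range (m + 2), ((m + 1).choose k : ℂ) * T k := by
    rw [delannoy]; push_cast; rfl
  have e0 : (delannoy m n : ℂ) =
      ∑ k ∈ Finset.range (m + 2), (m.choose (k + 1) : ℂ) * T (k + 1) + T 0 := by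
    rw [delannoy_eq_sum_of_lt (N := m + 3) (by omega), Finset.sum_range_succ']
    push_cast
    simp [hT]
  have hstep : ∀ k, (2 * (n : ℂ) + 1) * T k = ((k : ℂ) + 1) * T (k + 1) + (2 * k + 1) * T k := by
    intro k
    simp only [hT, pow_succ]
    linear_combination (-2 * 2 ^ k) * succ_mul_choose_succ_cast n k
  have e3 : ∑ k ∈ Finset.range (m + 2), ((m + 1).choose k : ℂ) * ((2 * k + 1) * T k) =
      ∑ k ∈ Finset.range (m + 2), ((m + 1).choose (k + 1) : ℂ) * ((2 * (k + 1) + 1) * T (k + 1)) +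
        T 0 := by
    have : ∑ k ∈ Finset.range (m + 2), ((m + 1).choose k : ℂ) * ((2 * k + 1) * T k) =
        ∑ k ∈ Finset.range (m + 3), ((m + 1).choose k : ℂ) * ((2 * k + 1) * T k) := by
      rw [Finset.sum_range_succ _ (m + 2), Nat.choose_eq_zero_of_lt (by omega : m + 1 < m + 2)]
      simp
    rw [this, Finset.sum_range_succ']
    simp
  have e4 : (2 * (n : ℂ) + 1) * (delannoy (m + 1) n : ℂ) =
      ∑ k ∈ Finset.range (m + 2), ((m + 1).choose k : ℂ) * (((k : ℂ) + 1) * T (k + 1)) +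
      ∑ k ∈ Finset.range (m + 2), ((m + 1).choose k : ℂ) * ((2 * k + 1) * T k) := by
    rw [e1, Finset.mul_sum, ← Finset.sum_add_distrib]
    refine Finset.sum_congr rfl fun k _ => ?_
    linear_combination ((m + 1).choose k : ℂ) * hstep k
  rw [e4, e3, e2, e0, mul_add, mul_add, Finset.mul_sum, Finset.mul_sum]
  have key : ∑ k ∈ Finset.range (m + 2), ((m : ℂ) + 2) * (((m + 2).choose (k + 1) : ℂ) * T (k + 1)) =
      ∑ k ∈ Finset.range (m + 2), ((m + 1).choose k : ℂ) * (((k : ℂ) + 1) * T (k + 1)) +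
      ∑ k ∈ Finset.range (m + 2), ((m + 1).choose (k + 1) : ℂ) * ((2 * (k + 1) + 1) * T (k + 1)) +
      ∑ k ∈ Finset.range (m + 2), ((m : ℂ) + 1) * ((m.choose (k + 1) : ℂ) * T (k + 1)) := by
    rw [← Finset.sum_add_distrib, ← Finset.sum_add_distrib]
    refine Finset.sum_congr rfl fun k _ => ?_
    have h1 := succ_mul_choose_succ_cast (m + 1) k
    have h2 := succ_mul_choose_cast m (k + 1)
    rw [Nat.choose_succ_succ' (m + 1) k]
    push_cast at h1 h2 ⊢
    linear_combination (-T (k + 1)) * h1 - T (k + 1) * h2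
  rw [key]
  ring

/-- At this point `2ν = -i(2n+1)`, and after removing `(-i)^m` the three-term recurrence is that of
the Delannoy numbers, because `m + 2α = m + 1`. -/
theorem eval_pollaczek_half (m n : ℕ) :
    (pollaczek (1 / 2) m).eval (-Complex.I * ((n : ℂ) + 1 / 2)) =
      (-Complex.I) ^ m * (delannoy m n : ℂ) := by
  induction m using Nat.strong_induction_on with
  | _ m ih =>
    match m with
    | 0 => simp [pollaczek, delannoy]
    | 1 =>
      simp [pollaczek, delannoy, Finset.sum_range_succ]
      ring
    | m + 2 =>
      have h1 := ih (m + 1) (by omega)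
      have h0 := ih m (by omega)
      have hr := delannoy_recurrence m n
      have hm : (m : ℂ) + 2 ≠ 0 := by exact_mod_cast (m + 1).succ_ne_zero
      rw [pollaczek, eval_mul, eval_sub, eval_mul, eval_mul, eval_mul, h1, h0]
      simp only [eval_C, eval_X]
      rw [one_div, inv_mul_eq_div, div_eq_iff hm]
      push_cast
      have hI : Complex.I ^ 2 = -1 := Complex.I_sq
      rw [pow_succ (-Complex.I) (m + 1), pow_succ (-Complex.I) m]
      linear_combination (-(-Complex.I) ^ m * Complex.I * Complex.I) * hr +
        (-(-Complex.I) ^ m * ((m : ℂ) + 1) * delannoy m n) * hI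

theorem jumpCoeffTerm_eq (a : ℕ → ℂ) (m n : ℕ) : jumpCoeffTerm a m n =
    (-Complex.I) ^ m * ((-1) ^ n / (n.factorial : ℂ) * (delannoy m n : ℂ) * a n) := by
  rw [jumpCoeffTerm, eval_pollaczek_half]
  ring

/-- For fixed `m` the growth in `n` is at most geometric, so `1/n!` makes the coefficient series
absolutely convergent. -/
theorem delannoy_le (m n : ℕ) : delannoy m n ≤ 3 ^ m * 2 ^ n := by
  have h3 : (3 : ℕ) ^ m = ∑ k ∈ Finset.range (m + 1), m.choose k * 2 ^ k := by
    have := add_pow 2 1 m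
    simp only [one_pow, mul_one] at this
    rw [show (3 : ℕ) = 2 + 1 from rfl, this]
    exact Finset.sum_congr rfl fun k _ => mul_comm _ _
  rw [delannoy, h3, Finset.sum_mul]
  refine Finset.sum_le_sum fun k _ => ?_
  rw [← mul_assoc]
  exact Nat.mul_le_mul_left _ (Nat.choose_le_two_pow n k)

theorem summable_delannoy_div_factorial (m : ℕ) :
    Summable fun n : ℕ => (delannoy m n : ℝ) / n.factorial := by
  refine Summable.of_nonneg_of_le (fun n => by positivity) (fun n => ?_)
    ((Real.summable_pow_div_factorial 2).mul_left (3 ^ m))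
  rw [← mul_div_assoc]
  gcongr
  exact_mod_cast delannoy_le m n

theorem hasSum_choose_mul_exp_series (x : ℝ) (k : ℕ) :
    HasSum (fun n : ℕ => (-x) ^ n / n.factorial * (n.choose k : ℝ))
      ((-x) ^ k / k.factorial * Real.exp (-x)) := by
  have h := (NormedSpace.expSeries_div_hasSum_exp (-x)).mul_left ((-x) ^ k / k.factorial)
  rw [← Real.exp_eq_exp_ℝ] at h
  have h2 : HasSum (fun j : ℕ => (-x) ^ (j + k) / (j + k).factorial * ((j + k).choose k : ℝ))
      ((-x) ^ k / k.factorial * Real.exp (-x)) := by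
    refine h.congr_fun fun j => ?_
    rw [← Nat.add_choose_mul_factorial_mul_factorial j k, pow_add]
    have h3 : ((j + k).choose k : ℝ) ≠ 0 := by
      exact_mod_cast (Nat.choose_pos (Nat.le_add_left k j)).ne'
    push_cast
    field_simp
  rw [← hasSum_nat_add_iff' k]
  rw [Finset.sum_eq_zero, sub_zero]
  · exact h2
  · intro i hi
    rw [Nat.choose_eq_zero_of_lt (Finset.mem_range.mp hi)]
    simp

/-- Since `(n choose k)/n! = 1/(k! (n-k)!)`, each summand of the Delannoy number yields `e^{-x}`
times one monomial of `L_m(2x)`. This identity links the Pollaczek side to the Laguerre side. -/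
theorem hasSum_delannoy (x : ℝ) (m : ℕ) :
    HasSum (fun n : ℕ => (-x) ^ n / n.factorial * (delannoy m n : ℝ))
      ((laguerre m).eval (2 * x) * Real.exp (-x)) := by
  have h := hasSum_sum fun k (_ : k ∈ Finset.range (m + 1)) =>
    (hasSum_choose_mul_exp_series x k).mul_left ((m.choose k : ℝ) * 2 ^ k)
  convert! h using 1
  · funext n
    rw [delannoy, Nat.cast_sum, Finset.mul_sum]
    refine Finset.sum_congr rfl fun k _ => ?_
    push_cast
    ring
  · rw [eval_laguerre, Finset.sum_mul]
    refine Finset.sum_congr rfl fun k _ => ?_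
    rw [mul_pow, neg_pow x]
    ring

/-- The generating series is integrated termwise against `φ`; on the support `|xⁿ| ≤ 1`, so the
integrals are dominated by a convergent series. -/
theorem hasSum_jumpCoeffTerm {a : ℕ → ℂ} {φ : ℝ → ℂ} (hφ : Integrable φ)
    (hsupp : ∀ x ∉ Set.Ioo (0 : ℝ) 1, φ x = 0)
    (ha : ∀ n : ℕ, ∫ x : ℝ, (x : ℂ) ^ n * φ x = a n) (m : ℕ) :
    Summable (jumpCoeffTerm a m) ∧
      jumpCoeff a m = (-Complex.I) ^ m * ∫ x in Set.Ioi (0 : ℝ), (laguerreL2 m x : ℂ) * φ x := by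
  set F : ℕ → ℝ → ℂ := fun n x =>
    ((-1) ^ n / (n.factorial : ℂ) * (delannoy m n : ℂ)) * ((x : ℂ) ^ n * φ x) with hF
  have hbound : ∀ n x, ‖F n x‖ ≤ (delannoy m n : ℝ) / n.factorial * ‖φ x‖ := by
    intro n x
    by_cases hx : x ∈ Set.Ioo (0 : ℝ) 1
    · simp only [hF, norm_mul, norm_div, norm_pow, norm_neg, norm_one, one_pow,
        Complex.norm_natCast, Complex.norm_real, Real.norm_of_nonneg hx.1.le]
      rw [div_mul_eq_mul_div, one_mul]
      gcongr
      exact mul_le_of_le_one_left (norm_nonneg _) (pow_le_one₀ hx.1.le hx.2.le)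
    · simp [hF, hsupp x hx]
  have hFi : ∀ n, Integrable (F n) := fun n =>
    (hφ.norm.const_mul _).mono' (((by fun_prop : Continuous fun t : ℝ =>
      (t : ℂ) ^ n).aestronglyMeasurable.mul hφ.aestronglyMeasurable).const_mul _)
      (Eventually.of_forall (hbound n))
  have hsum : Summable fun n => ∫ x, ‖F n x‖ := by
    refine Summable.of_nonneg_of_le (fun n => integral_nonneg fun t => norm_nonneg _) (fun n => ?_)
      ((summable_delannoy_div_factorial m).mul_right (∫ t, ‖φ t‖))
    rw [← integral_const_mul]
    exact integral_mono (hFi n).norm (hφ.norm.const_mul _) (hbound n)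
  have h := (hasSum_integral_of_summable_integral_norm hFi hsum).mul_left ((-Complex.I) ^ m)
  have e1 : (fun n => (-Complex.I) ^ m * ∫ x, F n x) = jumpCoeffTerm a m := by
    funext n
    rw [jumpCoeffTerm_eq, hF]
    simp only [integral_const_mul, ha]
  rw [e1] at h
  refine ⟨h.summable, ?_⟩
  rw [jumpCoeff, h.tsum_eq, mul_left_comm, ← integral_const_mul]
  congr 1
  rw [setIntegral_eq_integral_of_forall_compl_eq_zero]
  · refine integral_congr_ae (Eventually.of_forall fun x => ?_)
    have h1 := ((Complex.hasSum_ofReal.mpr (hasSum_delannoy x m)).mul_right (φ x)).tsum_eq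
    simp only [laguerreL2]
    push_cast at h1 ⊢
    rw [mul_assoc, mul_assoc, ← mul_assoc _ _ (φ x), ← h1]
    congr 1
    refine tsum_congr fun n => ?_
    rw [hF]
    simp only
    rw [neg_pow (x : ℂ)]
    ring
  · intro x hx
    rw [hsupp x fun h => hx h.1, mul_zero]

/-! ### Return to the variable `v` and the expansion of the jump. -/

/-- The substitution `x = e^{-v}` does not increase `L²` norms. -/
theorem eLpNorm_comp_exp_neg_le (G : ℝ → ℂ) :
    eLpNorm (fun v : ℝ => (Real.exp (-v / 2) : ℂ) * G (Real.exp (-v))) 2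
      (volume.restrict (Set.Ioi 0)) ≤ eLpNorm G 2 (volume.restrict (Set.Ioi 0)) := by
  rw [eLpNorm_eq_lintegral_rpow_enorm_toReal (by norm_num) (by norm_num),
    eLpNorm_eq_lintegral_rpow_enorm_toReal (by norm_num) (by norm_num)]
  refine ENNReal.rpow_le_rpow ?_ (by positivity)
  have h := lintegral_image_eq_lintegral_abs_deriv_mul (s := Set.Ioi (0 : ℝ))
    (f := fun v => Real.exp (-v)) (f' := fun v => -Real.exp (-v)) measurableSet_Ioi
    (fun v _ => by
      have := ((hasDerivAt_id v).neg).exp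
      simpa using this.hasDerivWithinAt)
    (fun x _ y _ hxy => by simpa using hxy) (fun x => ‖G x‖ₑ ^ (2 : ℝ))
  calc _ = ∫⁻ v in Set.Ioi (0 : ℝ), ENNReal.ofReal |-Real.exp (-v)| *
        ‖G (Real.exp (-v))‖ₑ ^ (2 : ℝ) := by
        refine lintegral_congr fun v => ?_
        rw [enorm_mul, ENNReal.toReal_ofNat, ENNReal.mul_rpow_of_nonneg _ _ (by norm_num),
          enorm_ofReal_of_nonneg (Real.exp_pos _).le, abs_neg, abs_of_pos (Real.exp_pos _),
          ENNReal.ofReal_rpow_of_pos (Real.exp_pos _), ← Real.exp_mul]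
        congr 3
        ring
    _ = ∫⁻ x in (fun v => Real.exp (-v)) '' Set.Ioi (0 : ℝ), ‖G x‖ₑ ^ (2 : ℝ) := h.symm
    _ ≤ _ := by
        rw [ENNReal.toReal_ofNat]
        refine lintegral_mono_set ?_
        rintro _ ⟨v, _, rfl⟩
        exact Real.exp_pos _

theorem jumpCoeff_mul_laguerreFun {a : ℕ → ℂ} {c : ℂ} {m : ℕ}
    (h : jumpCoeff a m = (-Complex.I) ^ m * c) (v : ℝ) :
    jumpCoeff a m * laguerreFun m v =
      (Real.exp (-v / 2) : ℂ) * (c * laguerreL2 m (Real.exp (-v))) := by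
  have hI : (-Complex.I) ^ m * Complex.I ^ m = 1 := by
    rw [← mul_pow, neg_mul, Complex.I_mul_I, neg_neg, one_pow]
  rw [h, laguerreFun, laguerreL2]
  push_cast
  linear_combination (c * (√2 : ℂ) * (((laguerre m).eval (2 * Real.exp (-v)) : ℝ) : ℂ) *
    Complex.exp (-Complex.exp (-v)) * Complex.exp (-v / 2)) * hI

theorem theorem2 (a : ℕ → ℂ) (ha : HausdorffL2 a) :
    (∀ m : ℕ, Summable (jumpCoeffTerm a m)) ∧
    (∃ f : ℂ → ℂ, IsHolomorphicExtension a f) ∧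
    ∀ f : ℂ → ℂ, IsHolomorphicExtension a f →
      (∃ F : ℝ → ℂ, IsJumpFunction f F) ∧
      ∀ F : ℝ → ℂ, IsJumpFunction f F →
        MemLp (fun v : ℝ => (Real.exp (v / 2) : ℂ) * F v) 2
          (volume.restrict (Set.Ioi (0 : ℝ))) ∧
        Tendsto
          (fun N : ℕ => eLpNorm
            (fun v : ℝ => (Real.exp (v / 2) : ℂ) * F v -
              ∑ m ∈ Finset.range N, jumpCoeff a m * laguerreFun m v)
            2 (volume.restrict (Set.Ioi (0 : ℝ))))
          atTop (𝓝 0) := by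
  obtain ⟨φ, hφ, hsupp, hmom⟩ := ha.exists_moments
  -- On a set of finite measure `L²` is contained in `L¹`, and `φ` vanishes off `(0, 1)`.
  have hφ1 : Integrable φ := by
    have h1 : IntegrableOn φ (Set.Ioo 0 1) := (hφ.restrict (Set.Ioo 0 1)).integrable (by norm_num)
    exact (integrableOn_iff_integrable_of_support_subset fun x hx =>
      by_contra fun h => hx (hsupp x h)).mp h1
  refine ⟨fun m => (hasSum_jumpCoeffTerm hφ1 hsupp hmom m).1,
    ⟨_, isHolomorphicExtension_trigExtension hφ1 hsupp hmom⟩, fun f hf => ?_⟩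
  obtain ⟨hJ, huniq⟩ := hf.ae_jump hφ hφ1 hsupp hmom
  refine ⟨⟨_, hJ⟩, fun F hF => ?_⟩
  have hae : (fun v : ℝ => (Real.exp (v / 2) : ℂ) * F v) =ᵐ[volume.restrict (Set.Ioi 0)]
      fun v : ℝ => (Real.exp (-v / 2) : ℂ) * φ (Real.exp (-v)) := by
    filter_upwards [huniq F hF] with v hv
    rw [hv, ← mul_assoc, ← Complex.ofReal_mul, ← Real.exp_add]
    congr 3
    ring
  have hφI : MemLp φ 2 (volume.restrict (Set.Ioi 0)) := hφ.restrict _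
  constructor
  · refine MemLp.ae_eq hae.symm ⟨?_, (eLpNorm_comp_exp_neg_le φ).trans_lt hφI.2⟩
    -- `φ` is only almost everywhere equal to a measurable function; composing with `e^{-v}`
    -- preserves this since null sets pull back to null sets.
    obtain ⟨ψ, hψ, hψe⟩ := hφ.aestronglyMeasurable
    have h1 : AEStronglyMeasurable (fun v : ℝ => φ (Real.exp (-v))) :=
      ⟨fun v => ψ (Real.exp (-v)), hψ.comp_measurable (by fun_prop), ae_comp_exp_neg hψe⟩
    exact ((by fun_prop : Continuous fun v : ℝ =>
      ((Real.exp (-v / 2) : ℝ) : ℂ)).aestronglyMeasurable.mul h1).restrict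
  · refine tendsto_of_tendsto_of_tendsto_of_le_of_le tendsto_const_nhds
      (tendsto_eLpNorm_sub_sum_laguerreL2 hφI) (fun N => zero_le) fun N => ?_
    refine le_trans (le_of_eq (eLpNorm_congr_ae ?_)) (eLpNorm_comp_exp_neg_le _)
    filter_upwards [hae] with v hv
    rw [hv, mul_sub, Finset.mul_sum]
    congr 1
    exact Finset.sum_congr rfl fun m _ =>
      jumpCoeff_mul_laguerreFun (hasSum_jumpCoeffTerm hφ1 hsupp hmom m).2 v
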